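/- For a real number $\gamma>0$ let $$\mathbb H_\gamma=\{(z_1,z_2)\in\mathbb C^2:\ |z_1|^{\gamma}<|z_2|<1\}.$$ For a domain $\Omega\subset\mathbb C^2$ let $A^2(\Omega)$ be the space of holomorphic functions on $\Omega$ that are square integrable with respect to Lebesgue measure $dV$. The Bergman kernel of $\Omega$ is the unique function $\mathbb B_\Omega:\Omega\times\Omega\to\mathbb C$ such that $\mathbb B_\Omega(\cdot,w)\in A^2(\Omega)$ for every $w\in\Omega$, $\mathbb B_\Omega(z,w)=\overline{\mathbb B_\Omega(w,z)}$ for all $z,w\in\Omega$, and $$f(z)=\int_\Omega \mathbb B_\Omega(z,w)f(w)\,dV(w)\qquad\text{for all } f\in A^2(\Omega),\ z\in\Omega .$$ The domain $\Omega$ is called Lu Qi-Keng if $\mathbb B_\Omega(z,w)\neq 0$ for all $z,w\in\Omega$. **Corollary.** For every integer $k\ge 2$, the fat Hartogs triangle $\mathbb H_k$ is not a Lu Qi-Keng domain; that is, there are points $z,w\in\mathbb H_k$ with $\mathbb B_{\mathbb H_k}(z,w)=0$. -/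

import Mathlib

open MeasureTheory

/-- The generalized Hartogs triangle of exponent `γ` in `ℂ²`:
the set of `(z₁, z₂)` with `|z₁|^γ < |z₂| < 1`. -/
def hartogsTriangle (γ : ℝ) : Set (ℂ × ℂ) :=
  {z | ‖z.1‖ ^ γ < ‖z.2‖ ∧ ‖z.2‖ < 1}

/-- Membership in the Bergman space `A²(Ω)`: `f` is holomorphic on `Ω` and square integrable on `Ω`
for Lebesgue measure on `ℂ²`. Values of `f` outside `Ω` play no role. -/
def MemBergman (Ω : Set (ℂ × ℂ)) (f : ℂ × ℂ → ℂ) : Prop :=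
  DifferentiableOn ℂ f Ω ∧ MemLp f 2 (volume.restrict Ω)

/-- `B` is the Bergman kernel of `Ω`: each `B(·, w)` with `w ∈ Ω` lies in `A²(Ω)`, `B` is conjugate
symmetric on `Ω × Ω`, and `B` reproduces every element of `A²(Ω)`. On `Ω × Ω` there is only one such
function, see `IsBergmanKernel.unique`. -/
structure IsBergmanKernel (Ω : Set (ℂ × ℂ)) (B : ℂ × ℂ → ℂ × ℂ → ℂ) : Prop where
  mem : ∀ w ∈ Ω, MemBergman Ω (fun z => B z w)
  conj_symm : ∀ z ∈ Ω, ∀ w ∈ Ω, B z w = starRingEnd ℂ (B w z)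
  reproducing : ∀ f : ℂ × ℂ → ℂ, MemBergman Ω f → ∀ z ∈ Ω, f z = ∫ w in Ω, B z w * f w

/-- The Bergman kernel of an open set is determined on `Ω × Ω`. -/
theorem IsBergmanKernel.unique {Ω : Set (ℂ × ℂ)} (hΩ : IsOpen Ω) {B C : ℂ × ℂ → ℂ × ℂ → ℂ}
    (hB : IsBergmanKernel Ω B) (hC : IsBergmanKernel Ω C) :
    ∀ z ∈ Ω, ∀ w ∈ Ω, B z w = C z w := by
  intro z hz w hw
  rw [hB.conj_symm z hz w hw, hB.reproducing _ (hC.mem w hw) z hz,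
    hC.reproducing _ (hB.mem z hz) w hw, ← integral_conj]
  refine setIntegral_congr_fun hΩ.measurableSet fun u hu => ?_
  simp only [map_mul]
  rw [← hB.conj_symm z hz u hu, ← hC.conj_symm u hu w hw, mul_comm]

/-- `Ω` is a Lu Qi-Keng domain: its Bergman kernel has no zeros on `Ω × Ω`. (The negation of this
says that `Ω` has a Bergman kernel and that this kernel vanishes at some point of `Ω × Ω`.) -/
def IsLuQiKeng (Ω : Set (ℂ × ℂ)) : Prop :=
  ∀ B : ℂ × ℂ → ℂ × ℂ → ℂ, IsBergmanKernel Ω B → ∀ z ∈ Ω, ∀ w ∈ Ω, B z w ≠ 0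

/-! The map Φ(p₁, p₂) = (p₁p₂, p₂ᵏ) is a k-sheeted covering of the Hartogs triangle by D × D* (disc
times punctured disc), with Jacobian k p₂ᵏ; its deck group is the k-th roots of unity, acting by
(c⁻¹p₁, c p₂). As `IsLuQiKeng` quantifies over all Bergman kernels, refuting it requires an actual
kernel, and the covering provides one in closed form.

If f is in A² of the triangle, then (f ∘ Φ) p₂ᵏ is in A²(D × D*). Square integrable functions extend
across the puncture, so the bidisc kernel reproduces this pullback (`discProd_reproducing`). Put x =
p₁ q̄₁ and y = p₂ q̄₂, and write (1 - x)⁻² = (1 - xᵏ)⁻² (1 + ⋯ + xᵏ⁻¹)², likewise for y. Expanding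
the two squares gives monomials xᴬyᴮ against a deck-invariant factor. Those with A ≢ B mod k
integrate to zero; the others are monomials in s = xy, t = yᵏ and sᵏ/t = xᵏ. Pushing the formula
down along Φ yields the rational function `kernelFun` of s and t (`isBergmanKernel_hartogsKernel`).

It remains to find a zero of the numerator. At s = 0 it equals 1 + Nt, where N counts pairs below k
with sum k; for k ≥ 3, N ≥ 2 and t = -1/N is attained inside the domain. For k = 2, N = 1 puts the
root on the boundary, and a zero is found at s = -1/4 instead. -/

open Set Metric Complex Filter Topology
open scoped Real ENNReal ComplexConjugate

/-! ### Polar coordinates and the Bergman kernel of the disc -/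

/-- Polar coordinates carry integrable functions to integrable functions. -/
theorem integrableOn_polarCoord_symm {f : ℂ → ℂ} (hf : Integrable f) :
    IntegrableOn (fun p : ℝ × ℝ => p.1 • f (Complex.polarCoord.symm p)) polarCoord.target := by
  have h1 : Integrable (fun p : ℝ × ℝ => f (measurableEquivRealProd.symm p)) :=
    (volume_preserving_equiv_real_prod.symm _).integrable_comp_of_integrable hf
  have h2 := h1.integrableOn (s := polarCoord.symm '' polarCoord.target)
  rw [integrableOn_image_iff_integrableOn_abs_det_fderiv_smul volume
    (polarCoord.open_target.measurableSet)
    (fun p _ => (hasFDerivAt_polarCoord_symm p).hasFDerivWithinAt) polarCoord.symm.injOn] at h2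
  refine h2.congr_fun (fun p hp => ?_) polarCoord.open_target.measurableSet
  simp only [det_fderivPolarCoordSymm]
  rw [abs_of_pos hp.1]
  rfl

/-- Integration over the unit disc in polar coordinates. -/
theorem integral_unitBall_eq_polar {f : ℂ → ℂ} (hf : IntegrableOn f (ball 0 1)) :
    ∫ w in ball (0 : ℂ) 1, f w =
      ∫ r in (0 : ℝ)..1, (r : ℂ) * ∫ θ in (0 : ℝ)..2 * π, f (circleMap 0 r θ) := by
  have hF : Integrable ((ball (0 : ℂ) 1).indicator f) :=
    (integrable_indicator_iff measurableSet_ball).2 hf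
  have hI := integrableOn_polarCoord_symm hF
  rw [← integral_indicator measurableSet_ball, ← Complex.integral_comp_polarCoord_symm]
  have ht : polarCoord.target = Ioi (0 : ℝ) ×ˢ Ioo (-π) π := rfl
  rw [ht] at hI ⊢
  rw [Measure.volume_eq_prod] at hI ⊢
  rw [setIntegral_prod _ hI, intervalIntegral.integral_of_le zero_le_one]
  have hs : Ioi (0 : ℝ) = Ioo 0 1 ∪ Ici 1 := by
    rw [Ioo_union_Ici_eq_Ioi zero_lt_one]
  have hsym : ∀ r θ : ℝ, Complex.polarCoord.symm (r, θ) = circleMap 0 r θ := by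
    intro r θ
    simp [circleMap, Complex.exp_mul_I]
  have hcong : ∀ r ∈ Ioi (0 : ℝ),
      ∫ θ in Ioo (-π) π, r • (ball (0 : ℂ) 1).indicator f (Complex.polarCoord.symm (r, θ)) =
      (Ioo (0 : ℝ) 1).indicator
        (fun r => (r : ℂ) * ∫ θ in (0 : ℝ)..2 * π, f (circleMap 0 r θ)) r := by
    intro r hr
    have hr0 : (0 : ℝ) < r := hr
    by_cases h1 : r < 1
    · rw [indicator_of_mem (show r ∈ Ioo (0 : ℝ) 1 from ⟨hr0, h1⟩)]
      have : ∀ θ : ℝ, circleMap 0 r θ ∈ ball (0 : ℂ) 1 := fun θ => by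
        simp [abs_of_pos hr0, h1]
      simp only [hsym, indicator_of_mem (this _)]
      rw [integral_smul, real_smul, ← integral_Ioc_eq_integral_Ioo,
        ← intervalIntegral.integral_of_le (by linarith [Real.pi_pos])]
      congr 1
      have hp : Function.Periodic (fun θ => f (circleMap 0 r θ)) (2 * π) := fun θ => by
        simp only [periodic_circleMap 0 r θ]
      have := hp.intervalIntegral_add_eq (-π) 0
      rw [zero_add] at this
      rw [← this]
      congr 1
      ring
    · rw [indicator_of_notMem (fun h => h1 h.2)]
      have : ∀ θ : ℝ, circleMap 0 r θ ∉ ball (0 : ℂ) 1 := fun θ => by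
        simpa [abs_of_pos hr0] using h1
      simp only [hsym, indicator_of_notMem (this _), smul_zero, integral_zero]
  rw [setIntegral_congr_fun measurableSet_Ioi hcong, setIntegral_indicator measurableSet_Ioo,
    integral_Ioc_eq_integral_Ioo]
  congr 2
  ext r
  simp +contextual

/-- The Szegő-type integral over a circle that yields the Bergman kernel of the disc. -/
theorem circle_bergman_integral {g : ℂ → ℂ} (hg : DifferentiableOn ℂ g (ball 0 1)) {z : ℂ}
    (hz : ‖z‖ < 1) {r : ℝ} (hr : 0 < r) (hr1 : r < 1) :
    ∫ θ in (0 : ℝ)..2 * π, ((1 - z * conj (circleMap 0 r θ)) ^ 2)⁻¹ * g (circleMap 0 r θ) =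
      2 * π * (g (z * r ^ 2) + z * r ^ 2 * deriv g (z * r ^ 2)) := by
  have hzr : ‖z * (r : ℂ) ^ 2‖ < r := by
    rw [norm_mul, norm_pow, norm_real, Real.norm_of_nonneg hr.le]
    have : ‖z‖ * r ^ 2 ≤ r ^ 2 := mul_le_of_le_one_left (by positivity) hz.le
    nlinarith
  have hmem : z * (r : ℂ) ^ 2 ∈ ball (0 : ℂ) 1 := by
    rw [mem_ball_zero_iff]; linarith
  have hgd : DifferentiableAt ℂ g (z * r ^ 2) := hg.differentiableAt (isOpen_ball.mem_nhds hmem)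
  -- On |w| = r one has w̄ = r²/w, so 1 - z w̄ = (w - z r²)/w and dθ = dw/(iw). The integral becomes
  -- Cauchy's formula for the derivative of w g(w) at z r².
  have hc := two_pi_I_inv_smul_circleIntegral_sub_sq_inv_smul_of_differentiable
    (U := ball (0 : ℂ) 1) isOpen_ball (c := 0) (R := r) (w₀ := z * r ^ 2)
    (f := fun w => w * g w) (closedBall_subset_ball hr1)
    (differentiableOn_id.mul hg) (by rwa [mem_ball_zero_iff])
  have hd : deriv (fun w => w * g w) (z * (r : ℂ) ^ 2) =
      g (z * r ^ 2) + z * r ^ 2 * deriv g (z * r ^ 2) := by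
    have := (hasDerivAt_id (z * (r : ℂ) ^ 2)).mul hgd.hasDerivAt
    rw [one_mul] at this
    exact this.deriv
  rw [hd] at hc
  rw [← hc, circleIntegral, smul_eq_mul]
  have h2 : ∀ x : ℂ, 2 * π * ((2 * π * I)⁻¹ * x) = (-I) * x := by
    intro x
    have : (π : ℂ) ≠ 0 := by exact_mod_cast Real.pi_ne_zero
    field_simp
    linear_combination x * I_sq
  rw [h2, ← intervalIntegral.integral_const_mul]
  congr 1
  ext θ
  set w := circleMap 0 r θ with hw
  have hwr : w * conj w = r ^ 2 := by
    rw [mul_conj, normSq_eq_norm_sq]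
    simp [hw]
  have hw0 : w ≠ 0 := circleMap_ne_center hr.ne'
  have hwn : ‖w‖ = r := by simp [hw, abs_of_pos hr]
  have hne : w - z * r ^ 2 ≠ 0 := by
    intro h
    rw [sub_eq_zero] at h
    rw [← h, hwn] at hzr
    exact lt_irrefl _ hzr
  have hne2 : 1 - z * conj w ≠ 0 := by
    intro h
    apply hne
    rw [← hwr]
    linear_combination w * h
  have he : w - z * r ^ 2 = w * (1 - z * conj w) := by rw [← hwr]; ring
  simp only [deriv_circleMap, smul_eq_mul]
  rw [← hw, he]
  field_simp
  linear_combination (g w) * I_sq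

/-- The Bergman kernel of the unit disc reproduces integrable holomorphic functions. -/
theorem unitBall_reproducing {g : ℂ → ℂ} (hg : DifferentiableOn ℂ g (ball 0 1))
    (hi : IntegrableOn g (ball 0 1)) {z : ℂ} (hz : ‖z‖ < 1) :
    ∫ w in ball (0 : ℂ) 1, ((1 - z * conj w) ^ 2)⁻¹ * g w = π * g z := by
  have hne : ∀ w ∈ ball (0 : ℂ) 1, 1 - ‖z‖ ≤ ‖1 - z * conj w‖ := by
    intro w hw
    rw [mem_ball_zero_iff] at hw
    have h1 := norm_sub_norm_le (1 : ℂ) (z * conj w)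
    rw [norm_one, norm_mul, RCLike.norm_conj] at h1
    have := mul_le_of_le_one_right (norm_nonneg z) hw.le
    linarith
  have hI : IntegrableOn (fun w => ((1 - z * conj w) ^ 2)⁻¹ * g w) (ball 0 1) := by
    refine hi.bdd_mul (c := ((1 - ‖z‖) ^ 2)⁻¹) ?_ ?_
    · exact Measurable.aestronglyMeasurable (by fun_prop)
    · filter_upwards [ae_restrict_mem measurableSet_ball] with w hw
      rw [norm_inv, norm_pow]
      have := hne w hw
      have h0 : 0 < 1 - ‖z‖ := by linarith
      gcongr
  rw [integral_unitBall_eq_polar hI]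
  have hmem : ∀ r ∈ Icc (0 : ℝ) 1, z * (r : ℂ) ^ 2 ∈ ball (0 : ℂ) 1 := by
    intro r hr
    rw [mem_ball_zero_iff, norm_mul, norm_pow, norm_real, Real.norm_of_nonneg hr.1]
    have : ‖z‖ * r ^ 2 ≤ ‖z‖ := mul_le_of_le_one_right (norm_nonneg z) (pow_le_one₀ hr.1 hr.2)
    linarith
  -- The radial integrand is the derivative of π r² g(z r²), which is 0 at r = 0 and π g(z) at r =
  -- 1.
  have hderiv : ∀ r ∈ uIcc (0 : ℝ) 1,
      HasDerivAt (fun r : ℝ => (π : ℂ) * (r : ℂ) ^ 2 * g (z * (r : ℂ) ^ 2))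
        ((r : ℂ) * (2 * π * (g (z * r ^ 2) + z * r ^ 2 * deriv g (z * r ^ 2)))) r := by
    intro r hr
    rw [uIcc_of_le zero_le_one] at hr
    have hgd := (hg.differentiableAt (isOpen_ball.mem_nhds (hmem r hr))).hasDerivAt
    have h2 : HasDerivAt (fun x : ℂ => x ^ 2) (2 * (r : ℂ)) (r : ℂ) := by
      simpa using hasDerivAt_pow 2 (r : ℂ)
    have h3 := (h2.const_mul (π : ℂ)).mul (HasDerivAt.comp (r : ℂ) hgd (h2.const_mul z))
    have h4 := h3.comp_ofReal
    refine h4.congr_deriv ?_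
    simp only [Function.comp_apply]
    ring
  have hcd : ContinuousOn (deriv g) (ball 0 1) := (hg.deriv isOpen_ball).continuousOn
  have hmap : ContinuousOn (fun r : ℝ => z * (r : ℂ) ^ 2) (uIcc 0 1) := by fun_prop
  have hmaps : MapsTo (fun r : ℝ => z * (r : ℂ) ^ 2) (uIcc 0 1) (ball 0 1) := by
    intro r hr
    rw [uIcc_of_le zero_le_one] at hr
    exact hmem r hr
  have hcont : ContinuousOn (fun r : ℝ =>
      (r : ℂ) * (2 * π * (g (z * r ^ 2) + z * r ^ 2 * deriv g (z * r ^ 2)))) (uIcc 0 1) := by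
    have h1 := hg.continuousOn.comp hmap hmaps
    have h2 := hcd.comp hmap hmaps
    have h0 : ContinuousOn (fun r : ℝ => (r : ℂ)) (uIcc 0 1) := by fun_prop
    exact h0.mul (continuousOn_const.mul (h1.add (hmap.mul h2)))
  have hftc := intervalIntegral.integral_eq_sub_of_hasDerivAt hderiv hcont.intervalIntegrable
  calc _ = ∫ r in (0 : ℝ)..1,
        (r : ℂ) * (2 * π * (g (z * r ^ 2) + z * r ^ 2 * deriv g (z * r ^ 2))) := by
        rw [intervalIntegral.integral_of_le zero_le_one,
          intervalIntegral.integral_of_le zero_le_one, integral_Ioc_eq_integral_Ioo,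
          integral_Ioc_eq_integral_Ioo]
        refine setIntegral_congr_fun measurableSet_Ioo fun r hr => ?_
        rw [circle_bergman_integral hg hz hr.1 hr.2]
    _ = π * g z := by
        rw [hftc]
        simp

/-! ### Sub-mean value inequality and removal of the puncture -/

theorem lintegral_ball_comp_affine (f : ℂ → ℝ≥0∞) (c : ℂ) {r : ℝ} (hr : 0 < r) :
    ∫⁻ w in ball (0 : ℂ) 1, f (c + r * w) =
      ENNReal.ofReal (r ^ 2)⁻¹ * ∫⁻ w in ball c r, f w := by
  have hmem : ∀ w : ℂ, c + r * w ∈ ball c r ↔ w ∈ ball (0 : ℂ) 1 := by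
    intro w
    rw [mem_ball_iff_norm, mem_ball_zero_iff, add_sub_cancel_left, norm_mul, norm_real,
      Real.norm_of_nonneg hr.le]
    exact mul_lt_iff_lt_one_right hr
  rw [← lintegral_indicator measurableSet_ball, ← lintegral_indicator measurableSet_ball,
    ← lintegral_add_left_eq_self ((ball c r).indicator f) c]
  have h := (Homeomorph.smulOfNeZero (α := ℂ) r hr.ne').measurableEmbedding.lintegral_map
    (μ := volume) (fun w => (ball c r).indicator f (c + w))
  have hm : Measure.map (Homeomorph.smulOfNeZero (α := ℂ) r hr.ne') (volume : Measure ℂ) =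
      ENNReal.ofReal |(r ^ Module.finrank ℝ ℂ)⁻¹| • volume :=
    Measure.map_addHaar_smul volume hr.ne'
  rw [hm, lintegral_smul_measure, finrank_real_complex, abs_of_pos (by positivity)] at h
  rw [← smul_eq_mul, h]
  refine lintegral_congr fun w => ?_
  simp only [Homeomorph.smulOfNeZero_apply, real_smul]
  by_cases hw : w ∈ ball (0 : ℂ) 1
  · rw [indicator_of_mem hw, indicator_of_mem ((hmem w).2 hw)]
  · rw [indicator_of_notMem hw, indicator_of_notMem (fun h => hw ((hmem w).1 h))]

/-- The sub-mean value inequality for `|g|²`. -/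
theorem enorm_sq_mul_le_lintegral_ball {g : ℂ → ℂ} {c : ℂ} {r : ℝ} (hr : 0 < r)
    (hg : DifferentiableOn ℂ g (ball c r)) :
    ENNReal.ofReal (π * r ^ 2) * ‖g c‖ₑ ^ 2 ≤ ∫⁻ w in ball c r, ‖g w‖ₑ ^ 2 := by
  have hmaps : MapsTo (fun w : ℂ => c + r * w) (ball 0 1) (ball c r) := by
    intro w hw
    rw [mem_ball_zero_iff] at hw
    rw [mem_ball_iff_norm, add_sub_cancel_left, norm_mul, norm_real, Real.norm_of_nonneg hr.le]
    exact mul_lt_of_lt_one_right hr hw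
  set G : ℂ → ℂ := fun w => g (c + r * w) ^ 2 with hG
  have hGd : DifferentiableOn ℂ G (ball 0 1) :=
    (hg.comp (by fun_prop) hmaps).pow 2
  have hkey : ENNReal.ofReal π * ‖g c‖ₑ ^ 2 ≤ ∫⁻ w in ball (0 : ℂ) 1, ‖G w‖ₑ := by
    -- If the integral is infinite there is nothing to prove; otherwise g² is integrable and the
    -- disc formula at z = 0 is its mean value property.
    by_cases htop : ∫⁻ w in ball (0 : ℂ) 1, ‖G w‖ₑ = ⊤
    · rw [htop]; exact le_top
    · have hi : IntegrableOn G (ball 0 1) :=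
        ⟨hGd.continuousOn.aestronglyMeasurable measurableSet_ball, lt_top_iff_ne_top.2 htop⟩
      have h := unitBall_reproducing hGd hi (z := 0) (by simp)
      have h2 := enorm_integral_le_lintegral_enorm (μ := volume.restrict (ball (0 : ℂ) 1)) G
      simp only [zero_mul, sub_zero, one_pow, inv_one, one_mul] at h
      rw [h] at h2
      simp only [hG, mul_zero, add_zero, enorm_mul, enorm_pow] at h2
      simp only [hG, enorm_pow]
      rwa [show ‖(π : ℂ)‖ₑ = ENNReal.ofReal π by
        rw [← ofReal_norm, norm_real, Real.norm_of_nonneg Real.pi_pos.le]] at h2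
  have hsc := lintegral_ball_comp_affine (fun w => ‖g w‖ₑ ^ 2) c hr
  simp only [hG, enorm_pow] at hkey
  rw [hsc] at hkey
  calc ENNReal.ofReal (π * r ^ 2) * ‖g c‖ₑ ^ 2
      = ENNReal.ofReal (r ^ 2) * (ENNReal.ofReal π * ‖g c‖ₑ ^ 2) := by
        rw [ENNReal.ofReal_mul Real.pi_pos.le]; ring
    _ ≤ ENNReal.ofReal (r ^ 2) * (ENNReal.ofReal (r ^ 2)⁻¹ * ∫⁻ w in ball c r, ‖g w‖ₑ ^ 2) := by
        gcongr
    _ = _ := by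
        rw [← mul_assoc, ← ENNReal.ofReal_mul (by positivity), mul_inv_cancel₀ (by positivity),
          ENNReal.ofReal_one, one_mul]

theorem lintegral_enorm_sq_lt_top {α : Type*} [MeasurableSpace α] {μ : Measure α} {f : α → ℂ}
    (hf : MemLp f 2 μ) : ∫⁻ x, ‖f x‖ₑ ^ 2 ∂μ < ⊤ := by
  have := (eLpNorm_lt_top_iff_lintegral_rpow_enorm_lt_top two_ne_zero ENNReal.ofNat_ne_top).1 hf.2
  simpa using this

theorem memLp_two_of_lintegral {α : Type*} [MeasurableSpace α] {μ : Measure α} {f : α → ℂ}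
    (hm : AEStronglyMeasurable f μ) (hf : ∫⁻ x, ‖f x‖ₑ ^ 2 ∂μ < ⊤) : MemLp f 2 μ := by
  refine ⟨hm, (eLpNorm_lt_top_iff_lintegral_rpow_enorm_lt_top two_ne_zero
    ENNReal.ofNat_ne_top).2 ?_⟩
  simpa using hf

theorem restrict_ball_diff_zero :
    volume.restrict (ball (0 : ℂ) 1 \ {0}) = volume.restrict (ball (0 : ℂ) 1) :=
  Measure.restrict_congr_set (sdiff_null_ae_eq_self (measure_singleton 0))

/-- Square integrable holomorphic functions on the punctured disc are `o(1/z)` at the puncture. -/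
theorem isLittleO_inv_of_memLp {g : ℂ → ℂ}
    (hg : DifferentiableOn ℂ g (ball 0 1 \ {0}))
    (hi : MemLp g 2 (volume.restrict (ball (0 : ℂ) 1 \ {0}))) :
    g =o[𝓝[≠] 0] fun z : ℂ => z⁻¹ := by
  rw [restrict_ball_diff_zero] at hi
  have hfin := lintegral_enorm_sq_lt_top hi
  set μ := volume.restrict (ball (0 : ℂ) 1) with hμ
  -- The ball of centre w and radius |w| avoids 0 and shrinks as w → 0, so by absolute continuity
  -- the integral of |g|² over it tends to 0. The sub-mean value inequality then forces |w g(w)| →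
  -- 0.
  have hvol : Tendsto (fun w : ℂ => μ (ball w ‖w‖)) (𝓝[≠] 0) (𝓝 0) := by
    have h1 : Tendsto (fun w : ℂ => ENNReal.ofReal ‖w‖ ^ 2 * NNReal.pi) (𝓝 0) (𝓝 0) := by
      have : Continuous (fun w : ℂ => ENNReal.ofReal (‖w‖ ^ 2 * NNReal.pi)) :=
        ENNReal.continuous_ofReal.comp (by fun_prop)
      have h := this.tendsto 0
      simp only [norm_zero, ne_eq, OfNat.ofNat_ne_zero, not_false_eq_true, zero_pow, zero_mul,
        ENNReal.ofReal_zero] at h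
      refine h.congr fun w => ?_
      rw [ENNReal.ofReal_mul (by positivity), ENNReal.ofReal_pow (by positivity),
        ENNReal.ofReal_coe_nnreal]
    refine tendsto_of_tendsto_of_tendsto_of_le_of_le tendsto_const_nhds
      (h1.mono_left nhdsWithin_le_nhds) (fun _ => zero_le) fun w => ?_
    exact (Measure.restrict_apply_le _ _).trans (Complex.volume_ball w ‖w‖).le
  have hlim := tendsto_setLIntegral_zero hfin.ne hvol
  rw [Asymptotics.isLittleO_iff]
  intro ε hε
  have hev := hlim.eventually (gt_mem_nhds (show (0 : ℝ≥0∞) < ENNReal.ofReal (π * ε ^ 2) by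
    rw [ENNReal.ofReal_pos]; positivity))
  filter_upwards [hev, self_mem_nhdsWithin,
    nhdsWithin_le_nhds (ball_mem_nhds (0 : ℂ) (show (0 : ℝ) < 1 / 2 by norm_num))] with w h1 h0 h2
  have hw0 : (0 : ℝ) < ‖w‖ := norm_pos_iff.2 h0
  rw [mem_ball_zero_iff] at h2
  have hsub : ball w ‖w‖ ⊆ ball 0 1 \ {0} := by
    intro u hu
    rw [mem_ball_iff_norm] at hu
    refine ⟨?_, ?_⟩
    · rw [mem_ball_zero_iff]
      have := norm_le_norm_add_norm_sub' u w
      linarith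
    · rintro rfl
      simp at hu
  have h3 := enorm_sq_mul_le_lintegral_ball hw0 (hg.mono hsub)
  rw [hμ, Measure.restrict_restrict measurableSet_ball,
    inter_eq_left.2 (hsub.trans sdiff_subset)] at h1
  have h4 := h3.trans_lt h1
  rw [← ofReal_norm, ← ENNReal.ofReal_pow (norm_nonneg _),
    ← ENNReal.ofReal_mul (by positivity), ENNReal.ofReal_lt_ofReal_iff (by positivity)] at h4
  have h5 : (‖w‖ * ‖g w‖) ^ 2 < ε ^ 2 := by
    have : π * (‖w‖ * ‖g w‖) ^ 2 < π * ε ^ 2 := by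
      calc _ = π * ‖w‖ ^ 2 * ‖g w‖ ^ 2 := by ring
        _ < _ := h4
    exact lt_of_mul_lt_mul_left this Real.pi_pos.le
  have h6 := lt_of_pow_lt_pow_left₀ 2 hε.le h5
  rw [norm_inv, ← div_eq_mul_inv, le_div_iff₀ hw0, mul_comm]
  exact h6.le

/-- The Bergman kernel of the disc reproduces square integrable holomorphic functions on the
punctured disc. -/
theorem puncturedBall_reproducing {g : ℂ → ℂ} (hg : DifferentiableOn ℂ g (ball 0 1 \ {0}))
    (hi : MemLp g 2 (volume.restrict (ball (0 : ℂ) 1 \ {0}))) {z : ℂ}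
    (hz : z ∈ ball (0 : ℂ) 1 \ {0}) :
    ∫ w in ball (0 : ℂ) 1 \ {0}, ((1 - z * conj w) ^ 2)⁻¹ * g w = π * g z := by
  have ho := isLittleO_inv_of_memLp hg hi
  -- The removability theorem subtracts `g 0`, an arbitrary value here; being constant, it is
  -- o(1/z).
  have ho' : (fun z => g z - g 0) =o[𝓝[≠] 0] fun z : ℂ => (z - 0)⁻¹ := by
    simp only [sub_zero]
    refine ho.sub ?_
    have : Tendsto (fun z : ℂ => ‖z⁻¹‖) (𝓝[≠] 0) atTop :=
      tendsto_norm_inv_nhdsNE_zero_atTop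
    exact Asymptotics.isLittleO_const_left.2 (Or.inr this)
  have hd := differentiableOn_update_limUnder_of_isLittleO
    (ball_mem_nhds (0 : ℂ) one_pos) hg ho'
  set G := Function.update g 0 (limUnder (𝓝[≠] 0) g) with hG
  have hEq : ∀ w ∈ ball (0 : ℂ) 1 \ {0}, G w = g w := fun w hw =>
    Function.update_of_ne hw.2 _ _
  have hms : MeasurableSet (ball (0 : ℂ) 1 \ {0}) :=
    measurableSet_ball.diff (measurableSet_singleton 0)
  have hfm : IsFiniteMeasure (volume.restrict (ball (0 : ℂ) 1 \ {0})) := by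
    rw [restrict_ball_diff_zero]
    exact ⟨by rw [Measure.restrict_apply_univ]; exact measure_ball_lt_top⟩
  have hint : IntegrableOn G (ball 0 1) := by
    rw [IntegrableOn, ← restrict_ball_diff_zero]
    refine (hi.integrable one_le_two).congr ?_
    filter_upwards [ae_restrict_mem hms] with w hw
    exact (hEq w hw).symm
  have h := unitBall_reproducing hd hint (mem_ball_zero_iff.1 hz.1)
  rw [hEq z hz, ← restrict_ball_diff_zero] at h
  rw [← h]
  refine setIntegral_congr_fun hms fun w hw => ?_
  simp only [hEq w hw]

/-! ### Reproducing formula on the disc times the punctured disc -/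

/-- The product of the unit disc and the punctured unit disc. -/
def discProd : Set (ℂ × ℂ) := ball (0 : ℂ) 1 ×ˢ (ball (0 : ℂ) 1 \ {0})

theorem isOpen_ball_diff_zero : IsOpen (ball (0 : ℂ) 1 \ {0}) :=
  isOpen_ball.sdiff isClosed_singleton

theorem isOpen_discProd : IsOpen discProd := isOpen_ball.prod isOpen_ball_diff_zero

theorem mem_discProd {p : ℂ × ℂ} : p ∈ discProd ↔ ‖p.1‖ < 1 ∧ ‖p.2‖ < 1 ∧ p.2 ≠ 0 := by
  simp [discProd, mem_prod]

theorem restrict_discProd : (volume : Measure (ℂ × ℂ)).restrict discProd =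
    (volume.restrict (ball (0 : ℂ) 1)).prod (volume.restrict (ball (0 : ℂ) 1 \ {0})) := by
  rw [Measure.prod_restrict]
  rfl

instance isFiniteMeasure_restrict_ball :
    IsFiniteMeasure (volume.restrict (ball (0 : ℂ) 1)) :=
  ⟨by rw [Measure.restrict_apply_univ]; exact measure_ball_lt_top⟩

instance isFiniteMeasure_restrict_ball_diff_zero :
    IsFiniteMeasure (volume.restrict (ball (0 : ℂ) 1 \ {0})) := by
  rw [restrict_ball_diff_zero]
  infer_instance

instance isFiniteMeasure_restrict_discProd :
    IsFiniteMeasure ((volume : Measure (ℂ × ℂ)).restrict discProd) := by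
  rw [restrict_discProd]
  infer_instance

theorem norm_bergman_disc_le {a q : ℂ} (ha : ‖a‖ < 1) (hq : ‖q‖ < 1) :
    ‖((1 - a * conj q) ^ 2)⁻¹‖ ≤ ((1 - ‖a‖) ^ 2)⁻¹ := by
  have h1 := norm_sub_norm_le (1 : ℂ) (a * conj q)
  rw [norm_one, norm_mul, RCLike.norm_conj] at h1
  have := mul_le_of_le_one_right (norm_nonneg a) hq.le
  have h0 : 0 < 1 - ‖a‖ := by linarith
  rw [norm_inv, norm_pow]
  gcongr
  linarith

/-- Slices of a square integrable holomorphic function on `discProd` are square integrable. -/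
theorem memLp_slice {F : ℂ × ℂ → ℂ} (hF : DifferentiableOn ℂ F discProd)
    (hi : MemLp F 2 (volume.restrict discProd)) {a : ℂ} (ha : ‖a‖ < 1) :
    MemLp (fun y => F (a, y)) 2 (volume.restrict (ball (0 : ℂ) 1 \ {0})) := by
  have hr : 0 < 1 - ‖a‖ := by linarith
  have hsub : ball a (1 - ‖a‖) ⊆ ball 0 1 := by
    refine ball_subset_ball' ?_
    rw [dist_zero_right]
    linarith
  have hcont : ContinuousOn (fun y => F (a, y)) (ball (0 : ℂ) 1 \ {0}) :=
    hF.continuousOn.comp (by fun_prop) fun y hy => ⟨mem_ball_zero_iff.2 ha, hy⟩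
  refine memLp_two_of_lintegral
    (hcont.aestronglyMeasurable isOpen_ball_diff_zero.measurableSet) ?_
  have hfin := lintegral_enorm_sq_lt_top hi
  have hm : AEMeasurable (fun p => ‖F p‖ₑ ^ 2) (volume.restrict discProd) :=
    hi.1.enorm.pow_const 2
  rw [restrict_discProd] at hfin hm
  rw [lintegral_prod_symm _ hm] at hfin
  set C := ENNReal.ofReal (π * (1 - ‖a‖) ^ 2) with hC
  have hC0 : C ≠ 0 := by
    rw [hC, ne_eq, ENNReal.ofReal_eq_zero, not_le]
    positivity
  -- Sub-mean value inequality in the first variable around `a`, integrated over the second.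
  have hle : C * ∫⁻ y in ball (0 : ℂ) 1 \ {0}, ‖F (a, y)‖ₑ ^ 2 ≤
      ∫⁻ y in ball (0 : ℂ) 1 \ {0}, ∫⁻ x in ball (0 : ℂ) 1, ‖F (x, y)‖ₑ ^ 2 := by
    rw [← lintegral_const_mul' _ _ ENNReal.ofReal_ne_top]
    refine setLIntegral_mono' isOpen_ball_diff_zero.measurableSet fun y hy => ?_
    have hd : DifferentiableOn ℂ (fun x => F (x, y)) (ball a (1 - ‖a‖)) :=
      hF.comp (by fun_prop) fun x hx => ⟨hsub hx, hy⟩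
    exact (enorm_sq_mul_le_lintegral_ball hr hd).trans (lintegral_mono_set hsub)
  have hlt := hle.trans_lt hfin
  by_contra htop
  rw [not_lt, top_le_iff] at htop
  rw [htop, ENNReal.mul_top hC0] at hlt
  exact lt_irrefl _ hlt

theorem measurable_bergman_disc (a : ℂ) : Measurable fun q : ℂ => ((1 - a * conj q) ^ 2)⁻¹ := by
  fun_prop

/-- The Bergman kernel of the bidisc reproduces square integrable holomorphic functions on
`discProd`. -/
theorem discProd_reproducing {F : ℂ × ℂ → ℂ} (hF : DifferentiableOn ℂ F discProd)
    (hi : MemLp F 2 (volume.restrict discProd)) {p : ℂ × ℂ} (hp : p ∈ discProd) :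
    ∫ q in discProd, ((1 - p.1 * conj q.1) ^ 2)⁻¹ * ((1 - p.2 * conj q.2) ^ 2)⁻¹ * F q =
      π ^ 2 * F p := by
  obtain ⟨a, b⟩ := p
  obtain ⟨ha, hb, hb0⟩ := mem_discProd.1 hp
  simp only at ha hb hb0 ⊢
  have hFi : Integrable F (volume.restrict discProd) := hi.integrable one_le_two
  have hI : Integrable (fun q : ℂ × ℂ =>
      ((1 - a * conj q.1) ^ 2)⁻¹ * ((1 - b * conj q.2) ^ 2)⁻¹ * F q)
      (volume.restrict discProd) := by
    refine hFi.bdd_mul (c := ((1 - ‖a‖) ^ 2)⁻¹ * ((1 - ‖b‖) ^ 2)⁻¹) ?_ ?_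
    · exact (((measurable_bergman_disc a).comp measurable_fst).mul
        ((measurable_bergman_disc b).comp measurable_snd)).aestronglyMeasurable
    · filter_upwards [ae_restrict_mem isOpen_discProd.measurableSet] with q hq
      obtain ⟨h1, h2, -⟩ := mem_discProd.1 hq
      rw [norm_mul]
      exact mul_le_mul (norm_bergman_disc_le ha h1) (norm_bergman_disc_le hb h2)
        (norm_nonneg _) (by positivity)
  rw [restrict_discProd] at hI hFi ⊢
  rw [integral_prod_symm _ hI]
  -- Fubini makes almost every slice in the first variable integrable, which is all the disc formula
  -- needs. The second integration is over the slice at the prescribed `a`, which an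
  -- almost-everywhere statement may miss, hence `memLp_slice`.
  have hin : ∀ᵐ y ∂(volume.restrict (ball (0 : ℂ) 1 \ {0})),
      ∫ x in ball (0 : ℂ) 1, ((1 - a * conj x) ^ 2)⁻¹ * ((1 - b * conj y) ^ 2)⁻¹ * F (x, y) =
        π * (((1 - b * conj y) ^ 2)⁻¹ * F (a, y)) := by
    filter_upwards [hFi.prod_left_ae, ae_restrict_mem isOpen_ball_diff_zero.measurableSet]
      with y hy hym
    have hd : DifferentiableOn ℂ (fun x => F (x, y)) (ball 0 1) :=
      hF.comp (by fun_prop) fun x hx => ⟨hx, hym⟩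
    have h := unitBall_reproducing hd hy ha
    calc _ = ∫ x in ball (0 : ℂ) 1,
          ((1 - b * conj y) ^ 2)⁻¹ * (((1 - a * conj x) ^ 2)⁻¹ * F (x, y)) := by
          congr 1; ext x; ring
      _ = _ := by rw [integral_const_mul, h]; ring
  rw [integral_congr_ae hin, integral_const_mul]
  have hd : DifferentiableOn ℂ (fun y => F (a, y)) (ball 0 1 \ {0}) :=
    hF.comp (by fun_prop) fun y hy => ⟨mem_ball_zero_iff.2 ha, hy⟩
  rw [puncturedBall_reproducing hd (memLp_slice hF hi ha) ⟨mem_ball_zero_iff.2 hb, hb0⟩]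
  ring

/-! ### The covering and its fundamental domain -/

/-- The `k`-sheeted covering of the Hartogs triangle of exponent `k` by `discProd`. -/
def hartogsCover (k : ℕ) (p : ℂ × ℂ) : ℂ × ℂ := (p.1 * p.2, p.2 ^ k)

/-- The deck transformations of `hartogsCover`. -/
noncomputable def deckRotation (c : Circle) (p : ℂ × ℂ) : ℂ × ℂ := ((c : ℂ)⁻¹ * p.1, (c : ℂ) * p.2)

/-- A fundamental domain of `hartogsCover`. -/
def hartogsSector (k : ℕ) : Set (ℂ × ℂ) :=
  {p | p ∈ discProd ∧ (p.2 ^ k) ^ ((k : ℂ)⁻¹) = p.2}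

theorem mem_hartogsTriangle_natCast {k : ℕ} {z : ℂ × ℂ} :
    z ∈ hartogsTriangle (k : ℝ) ↔ ‖z.1‖ ^ k < ‖z.2‖ ∧ ‖z.2‖ < 1 := by
  simp [hartogsTriangle]

theorem isOpen_hartogsTriangle_natCast (k : ℕ) : IsOpen (hartogsTriangle (k : ℝ)) := by
  have : hartogsTriangle (k : ℝ) = {z : ℂ × ℂ | ‖z.1‖ ^ k < ‖z.2‖} ∩ {z | ‖z.2‖ < 1} := by
    ext z
    exact mem_hartogsTriangle_natCast
  rw [this]
  exact (isOpen_lt (by fun_prop) (by fun_prop)).inter (isOpen_lt (by fun_prop) (by fun_prop))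

theorem snd_ne_zero_of_mem_hartogsTriangle {k : ℕ} {z : ℂ × ℂ}
    (hz : z ∈ hartogsTriangle (k : ℝ)) : z.2 ≠ 0 := by
  intro h
  have := (mem_hartogsTriangle_natCast.1 hz).1
  rw [h, norm_zero] at this
  exact absurd this (not_lt.2 (by positivity))

theorem hartogsCover_mem {k : ℕ} (hk : k ≠ 0) {p : ℂ × ℂ} (hp : p ∈ discProd) :
    hartogsCover k p ∈ hartogsTriangle (k : ℝ) := by
  obtain ⟨h1, h2, h3⟩ := mem_discProd.1 hp
  rw [mem_hartogsTriangle_natCast]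
  simp only [hartogsCover, norm_mul, norm_pow, mul_pow]
  have : 0 < ‖p.2‖ ^ k := pow_pos (norm_pos_iff.2 h3) k
  exact ⟨mul_lt_of_lt_one_left this (pow_lt_one₀ (norm_nonneg _) h1 hk),
    pow_lt_one₀ (norm_nonneg _) h2 hk⟩

theorem hartogsSector_subset (k : ℕ) : hartogsSector k ⊆ discProd := fun _ h => h.1

theorem measurableSet_hartogsSector (k : ℕ) : MeasurableSet (hartogsSector k) := by
  refine isOpen_discProd.measurableSet.inter (measurableSet_eq_fun ?_ measurable_snd)
  exact (measurable_snd.pow_const k).pow_const _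

theorem injOn_hartogsCover (k : ℕ) : InjOn (hartogsCover k) (hartogsSector k) := by
  intro p hp q hq h
  simp only [hartogsCover, Prod.mk.injEq] at h
  have h2 : p.2 = q.2 := by rw [← hp.2, ← hq.2, h.2]
  rw [h2] at h
  exact Prod.ext (mul_right_cancel₀ (mem_discProd.1 hq.1).2.2 h.1) h2

/-- With b the principal k-th root of z₂, the preimage is (z₁/b, b); the condition |z₁|ᵏ < |z₂| =
|b|ᵏ says exactly that |z₁/b| < 1. -/
theorem image_hartogsCover {k : ℕ} (hk : k ≠ 0) :
    hartogsCover k '' hartogsSector k = hartogsTriangle (k : ℝ) := by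
  apply Subset.antisymm
  · rintro _ ⟨p, hp, rfl⟩
    exact hartogsCover_mem hk hp.1
  · intro z hz
    obtain ⟨h1, h2⟩ := mem_hartogsTriangle_natCast.1 hz
    have hz0 := snd_ne_zero_of_mem_hartogsTriangle hz
    set b := z.2 ^ ((k : ℂ)⁻¹) with hb
    have hbk : b ^ k = z.2 := cpow_nat_inv_pow _ hk
    have hb0 : b ≠ 0 := by
      rintro h
      rw [h, zero_pow hk] at hbk
      exact hz0 hbk.symm
    have hbn : 0 < ‖b‖ := norm_pos_iff.2 hb0
    refine ⟨(z.1 / b, b), ⟨mem_discProd.2 ⟨?_, ?_, hb0⟩, ?_⟩, ?_⟩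
    · rw [norm_div, div_lt_one hbn]
      rw [← hbk, norm_pow] at h1
      exact lt_of_pow_lt_pow_left₀ k hbn.le h1
    · rw [← hbk, norm_pow] at h2
      exact (pow_lt_one_iff_of_nonneg hbn.le hk).1 h2
    · simp only [hbk]
      exact hb.symm
    · simp only [hartogsCover, hbk, div_mul_cancel₀ _ hb0]

/-- The derivative of `hartogsCover`. -/
noncomputable def hartogsCoverDeriv (k : ℕ) (p : ℂ × ℂ) : ℂ × ℂ →L[ℂ] ℂ × ℂ :=
  (Matrix.toLin (.finTwoProd ℂ) (.finTwoProd ℂ)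
    !![p.2, p.1; 0, k * p.2 ^ (k - 1)]).toContinuousLinearMap

theorem hasFDerivAt_hartogsCover (k : ℕ) (p : ℂ × ℂ) :
    HasFDerivAt (hartogsCover k) (hartogsCoverDeriv k p) p := by
  unfold hartogsCoverDeriv
  rw [Matrix.toLin_finTwoProd_toContinuousLinearMap]
  have h1 : HasFDerivAt (fun q : ℂ × ℂ => q.1 * q.2) _ p :=
    (hasFDerivAt_fst (𝕜 := ℂ) (p := p)).mul (hasFDerivAt_snd (𝕜 := ℂ) (p := p))
  have h2 : HasFDerivAt (fun q : ℂ × ℂ => q.2 ^ k) _ p :=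
    (hasDerivAt_pow k p.2).comp_hasFDerivAt p (hasFDerivAt_snd (𝕜 := ℂ) (p := p))
  refine (h1.prodMk h2).congr_fderiv ?_
  ext <;> simp

/-- The real determinant of a complex linear map is the squared modulus of its complex determinant,
here k p₂ᵏ. -/
theorem det_hartogsCoverDeriv {k : ℕ} (hk : k ≠ 0) (p : ℂ × ℂ) :
    ((hartogsCoverDeriv k p).restrictScalars ℝ).det = k ^ 2 * ‖p.2‖ ^ (2 * k) := by
  have h1 : ((hartogsCoverDeriv k p).restrictScalars ℝ).det =
      (((hartogsCoverDeriv k p : ℂ × ℂ →ₗ[ℂ] ℂ × ℂ)).restrictScalars ℝ).det := rfl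
  rw [h1, LinearMap.det_restrictScalars]
  unfold hartogsCoverDeriv
  simp only [LinearMap.coe_toContinuousLinearMap, LinearMap.det_toLin, Matrix.det_fin_two_of,
    mul_zero, sub_zero, Algebra.norm_complex_apply, normSq_eq_norm_sq]
  obtain ⟨n, rfl⟩ := Nat.exists_eq_succ_of_ne_zero hk
  simp only [norm_mul, norm_pow, norm_natCast, Nat.succ_eq_add_one, Nat.add_sub_cancel]
  ring

theorem hasFDerivWithinAt_hartogsCover_real (k : ℕ) (s : Set (ℂ × ℂ)) :
    ∀ p ∈ s, HasFDerivWithinAt (𝕜 := ℝ) (hartogsCover k)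
      ((hartogsCoverDeriv k p).restrictScalars ℝ) s p := fun p _ =>
  ((hasFDerivAt_hartogsCover k p).restrictScalars ℝ).hasFDerivWithinAt

instance isAddHaarMeasure_volume_complex_prod :
    Measure.IsAddHaarMeasure (volume : Measure (ℂ × ℂ)) :=
  Measure.prod.instIsAddHaarMeasure _ _

/-! ### Rotations -/

theorem deckRotation_eq_prodMap (c : Circle) :
    deckRotation c = Prod.map (rotation c⁻¹) (rotation c) := by
  funext p
  simp only [deckRotation, Prod.map, rotation_apply, Circle.coe_inv]

theorem measurePreserving_deckRotation (c : Circle) :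
    MeasurePreserving (deckRotation c) (volume : Measure (ℂ × ℂ)) volume := by
  rw [deckRotation_eq_prodMap]
  exact ((rotation c⁻¹).measurePreserving).prod ((rotation c).measurePreserving)

theorem measurableEmbedding_deckRotation (c : Circle) :
    MeasurableEmbedding (deckRotation c) := by
  rw [deckRotation_eq_prodMap]
  exact ((rotation c⁻¹).toHomeomorph.prodCongr (rotation c).toHomeomorph).measurableEmbedding

theorem deckRotation_mem_discProd (c : Circle) {p : ℂ × ℂ} :
    deckRotation c p ∈ discProd ↔ p ∈ discProd := by
  simp [mem_discProd, deckRotation, Circle.norm_coe]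

theorem hartogsCover_deckRotation {k : ℕ} {c : Circle} (hc : (c : ℂ) ^ k = 1) (p : ℂ × ℂ) :
    hartogsCover k (deckRotation c p) = hartogsCover k p := by
  have : (c : ℂ) ≠ 0 := c.coe_ne_zero
  simp only [hartogsCover, deckRotation, mul_pow, hc, one_mul, Prod.mk.injEq, and_true]
  field_simp

/-- A primitive `k`-th root of unity on the circle. -/
noncomputable def circleRoot (k : ℕ) : Circle := Circle.exp (2 * π / k)

theorem isPrimitiveRoot_circleRoot {k : ℕ} (hk : k ≠ 0) :
    IsPrimitiveRoot (circleRoot k : ℂ) k := by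
  have := Complex.isPrimitiveRoot_exp k hk
  convert this using 1
  rw [circleRoot, Circle.coe_exp]
  congr 1
  push_cast
  ring

/-- The translates of the fundamental domain. -/
def sectorTranslate (k j : ℕ) : Set (ℂ × ℂ) :=
  deckRotation (circleRoot k ^ j) ⁻¹' hartogsSector k

theorem circleRoot_pow_pow {k : ℕ} (hk : k ≠ 0) (j : ℕ) :
    ((circleRoot k ^ j : Circle) : ℂ) ^ k = 1 := by
  rw [Circle.coe_pow, ← pow_mul, mul_comm, pow_mul, (isPrimitiveRoot_circleRoot hk).pow_eq_one,
    one_pow]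

theorem measurableSet_sectorTranslate (k j : ℕ) : MeasurableSet (sectorTranslate k j) :=
  (measurableEmbedding_deckRotation _).measurable (measurableSet_hartogsSector k)

/-- Rotation leaves p₂ᵏ fixed, so the translates sort points by which root of unity carries p₂ to
the principal root of p₂ᵏ. Covering and disjointness both follow. -/
theorem mem_sectorTranslate {k : ℕ} (hk : k ≠ 0) {j : ℕ} {p : ℂ × ℂ} :
    p ∈ sectorTranslate k j ↔
      p ∈ discProd ∧ (p.2 ^ k) ^ ((k : ℂ)⁻¹) = (circleRoot k : ℂ) ^ j * p.2 := by
  have h := circleRoot_pow_pow hk j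
  rw [sectorTranslate, mem_preimage, hartogsSector, mem_ofPred_eq, deckRotation_mem_discProd]
  simp only [deckRotation]
  rw [mul_pow, h, one_mul, Circle.coe_pow]

theorem iUnion_sectorTranslate {k : ℕ} (hk : k ≠ 0) :
    ⋃ j ∈ Finset.range k, sectorTranslate k j = discProd := by
  ext p
  simp only [mem_iUnion, Finset.mem_range, exists_prop, mem_sectorTranslate hk]
  constructor
  · rintro ⟨j, -, h, -⟩
    exact h
  · intro hp
    have hp0 := (mem_discProd.1 hp).2.2
    have : NeZero k := ⟨hk⟩
    obtain ⟨j, hj, h⟩ := (isPrimitiveRoot_circleRoot hk).eq_pow_of_pow_eq_one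
      (ξ := (p.2 ^ k) ^ ((k : ℂ)⁻¹) / p.2) (by
        rw [div_pow, cpow_nat_inv_pow _ hk, div_self (pow_ne_zero k hp0)])
    exact ⟨j, hj, hp, by rw [h, div_mul_cancel₀ _ hp0]⟩

theorem pairwiseDisjoint_sectorTranslate {k : ℕ} (hk : k ≠ 0) :
    (Finset.range k : Set ℕ).PairwiseDisjoint (sectorTranslate k) := by
  intro i hi j hj hij
  rw [Function.onFun, Set.disjoint_left]
  intro p h1 h2
  obtain ⟨hp, e1⟩ := (mem_sectorTranslate hk).1 h1
  obtain ⟨-, e2⟩ := (mem_sectorTranslate hk).1 h2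
  rw [e1] at e2
  exact hij ((isPrimitiveRoot_circleRoot hk).pow_inj (by simpa using hi) (by simpa using hj)
    (mul_right_cancel₀ (mem_discProd.1 hp).2.2 e2))

theorem norm_deckRotation_snd (c : Circle) (p : ℂ × ℂ) : ‖(deckRotation c p).2‖ = ‖p.2‖ := by
  simp [deckRotation, Circle.norm_coe]

/-! ### Change of variables along the covering -/

/-- Change of variables along `hartogsCover`, for the lower integral. -/
theorem lintegral_hartogsCover {k : ℕ} (hk : k ≠ 0) (G : ℂ × ℂ → ℝ≥0∞) :
    ∫⁻ p in discProd, ENNReal.ofReal (k ^ 2 * ‖p.2‖ ^ (2 * k)) * G (hartogsCover k p) =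
      k * ∫⁻ z in hartogsTriangle (k : ℝ), G z := by
  rw [← iUnion_sectorTranslate hk, lintegral_biUnion_finset (pairwiseDisjoint_sectorTranslate hk)
    (fun j _ => measurableSet_sectorTranslate k j)]
  -- The deck rotation preserves the measure, |p₂| and the covering map, so each of the k sectors
  -- contributes the same amount.
  have h : ∀ j ∈ Finset.range k, ∫⁻ p in sectorTranslate k j,
      ENNReal.ofReal (k ^ 2 * ‖p.2‖ ^ (2 * k)) * G (hartogsCover k p) =
      ∫⁻ z in hartogsTriangle (k : ℝ), G z := by
    intro j _
    have hc := circleRoot_pow_pow hk j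
    rw [← image_hartogsCover hk, lintegral_image_eq_lintegral_abs_det_fderiv_mul volume
      (measurableSet_hartogsSector k) (hasFDerivWithinAt_hartogsCover_real k _)
      (injOn_hartogsCover k)]
    have e := (measurePreserving_deckRotation (circleRoot k ^ j)).setLIntegral_comp_preimage_emb
      (measurableEmbedding_deckRotation _)
      (fun p => ENNReal.ofReal (k ^ 2 * ‖p.2‖ ^ (2 * k)) * G (hartogsCover k p)) (hartogsSector k)
    simp only [hartogsCover_deckRotation hc, norm_deckRotation_snd] at e
    rw [sectorTranslate, e]
    refine lintegral_congr fun p => ?_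
    rw [det_hartogsCoverDeriv hk, abs_of_nonneg (by positivity)]
  rw [Finset.sum_congr rfl h, Finset.sum_const, Finset.card_range, nsmul_eq_mul]

/-- Change of variables along `hartogsCover`, for the Bochner integral. -/
theorem integral_hartogsCover {k : ℕ} (hk : k ≠ 0) (G : ℂ × ℂ → ℂ)
    (hG : IntegrableOn (fun p => ((k ^ 2 * ‖p.2‖ ^ (2 * k) : ℝ) : ℂ) * G (hartogsCover k p))
      discProd) :
    ∫ p in discProd, ((k ^ 2 * ‖p.2‖ ^ (2 * k) : ℝ) : ℂ) * G (hartogsCover k p) =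
      k * ∫ z in hartogsTriangle (k : ℝ), G z := by
  rw [← iUnion_sectorTranslate hk] at hG ⊢
  rw [integral_biUnion_finset _ (fun j _ => measurableSet_sectorTranslate k j)
    (pairwiseDisjoint_sectorTranslate hk)
    (fun j hj => hG.mono_set (subset_biUnion_of_mem (u := sectorTranslate k) hj))]
  have h : ∀ j ∈ Finset.range k, ∫ p in sectorTranslate k j,
      ((k ^ 2 * ‖p.2‖ ^ (2 * k) : ℝ) : ℂ) * G (hartogsCover k p) =
      ∫ z in hartogsTriangle (k : ℝ), G z := by
    intro j _
    have hc := circleRoot_pow_pow hk j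
    rw [← image_hartogsCover hk, integral_image_eq_integral_abs_det_fderiv_smul volume
      (measurableSet_hartogsSector k) (hasFDerivWithinAt_hartogsCover_real k _)
      (injOn_hartogsCover k)]
    have e := (measurePreserving_deckRotation (circleRoot k ^ j)).setIntegral_preimage_emb
      (measurableEmbedding_deckRotation _)
      (fun p => ((k ^ 2 * ‖p.2‖ ^ (2 * k) : ℝ) : ℂ) * G (hartogsCover k p)) (hartogsSector k)
    simp only [hartogsCover_deckRotation hc, norm_deckRotation_snd] at e
    rw [sectorTranslate, e]
    refine integral_congr_ae (ae_of_all _ fun p => ?_)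
    simp only
    rw [det_hartogsCoverDeriv hk, abs_of_nonneg (by positivity), real_smul]
  rw [Finset.sum_congr rfl h, Finset.sum_const, Finset.card_range, nsmul_eq_mul]

/-! ### The explicit kernel: symmetry, holomorphy, square integrability -/

/-- The average of `x ^ A * y ^ B` over the deck group, in the variables `s = x * y`,
`t = y ^ k`, for `A` and `B` less than `2 * k`. -/
noncomputable def averagedMonomial (k : ℕ) (s t : ℂ) (A B : ℕ) : ℂ :=
  if A = B then s ^ A
  else if A = B + k then s ^ B * (s ^ k / t)
  else if B = A + k then s ^ A * t
  else 0

/-- The index set of the numerator of the kernel. -/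
def kernelIndex (k : ℕ) : Finset ((ℕ × ℕ) × (ℕ × ℕ)) :=
  (Finset.range k ×ˢ Finset.range k) ×ˢ (Finset.range k ×ˢ Finset.range k)

/-- The numerator of the kernel. -/
noncomputable def kernelNumerator (k : ℕ) (s t : ℂ) : ℂ :=
  ∑ τ ∈ kernelIndex k, averagedMonomial k s t (τ.1.1 + τ.1.2) (τ.2.1 + τ.2.2)

/-- The Bergman kernel of the Hartogs triangle of exponent `k`, as a function of
`s = z₁ * conj w₁` and `t = z₂ * conj w₂`. -/
noncomputable def kernelFun (k : ℕ) (s t : ℂ) : ℂ :=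
  kernelNumerator k s t / (π ^ 2 * k * t * (1 - s ^ k / t) ^ 2 * (1 - t) ^ 2)

/-- The Bergman kernel of the Hartogs triangle of exponent `k`. -/
noncomputable def hartogsKernel (k : ℕ) (z w : ℂ × ℂ) : ℂ :=
  kernelFun k (z.1 * conj w.1) (z.2 * conj w.2)

theorem conj_averagedMonomial (k : ℕ) (s t : ℂ) (A B : ℕ) :
    conj (averagedMonomial k s t A B) = averagedMonomial k (conj s) (conj t) A B := by
  unfold averagedMonomial
  split_ifs <;> simp

theorem conj_kernelFun (k : ℕ) (s t : ℂ) :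
    conj (kernelFun k s t) = kernelFun k (conj s) (conj t) := by
  simp [kernelFun, kernelNumerator, conj_averagedMonomial]

theorem hartogsKernel_conj_symm (k : ℕ) (z w : ℂ × ℂ) :
    hartogsKernel k z w = conj (hartogsKernel k w z) := by
  simp [hartogsKernel, conj_kernelFun, mul_comm]

/-- The bound is uniform in z and below 1 for w in the triangle, so for fixed w the factor (1 -
sᵏ/t)⁻² is bounded. -/
theorem norm_ratio_le {k : ℕ} {z w : ℂ × ℂ} (hz : z ∈ hartogsTriangle (k : ℝ)) :
    ‖(z.1 * conj w.1) ^ k / (z.2 * conj w.2)‖ ≤ ‖w.1‖ ^ k / ‖w.2‖ := by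
  have hz0 : 0 < ‖z.2‖ := norm_pos_iff.2 (snd_ne_zero_of_mem_hartogsTriangle hz)
  have h1 := (mem_hartogsTriangle_natCast.1 hz).1
  have h2 : ‖z.1‖ ^ k / ‖z.2‖ ≤ 1 := (div_le_one hz0).2 h1.le
  calc _ = (‖z.1‖ ^ k / ‖z.2‖) * (‖w.1‖ ^ k / ‖w.2‖) := by
        rw [norm_div, norm_pow, norm_mul, norm_mul, RCLike.norm_conj, RCLike.norm_conj, mul_pow,
          mul_div_mul_comm]
    _ ≤ _ := mul_le_of_le_one_left (by positivity) h2

theorem norm_snd_mul_le {k : ℕ} {z w : ℂ × ℂ} (hz : z ∈ hartogsTriangle (k : ℝ)) :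
    ‖z.2 * conj w.2‖ ≤ ‖w.2‖ := by
  rw [norm_mul, RCLike.norm_conj]
  exact mul_le_of_le_one_left (norm_nonneg _) (mem_hartogsTriangle_natCast.1 hz).2.le

theorem ratio_lt_one {k : ℕ} {w : ℂ × ℂ} (hw : w ∈ hartogsTriangle (k : ℝ)) :
    ‖w.1‖ ^ k / ‖w.2‖ < 1 :=
  (div_lt_one (norm_pos_iff.2 (snd_ne_zero_of_mem_hartogsTriangle hw))).2
    (mem_hartogsTriangle_natCast.1 hw).1

theorem norm_fst_lt_one {k : ℕ} {w : ℂ × ℂ} (hw : w ∈ hartogsTriangle (k : ℝ)) :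
    ‖w.1‖ < 1 := by
  obtain ⟨h1, h2⟩ := mem_hartogsTriangle_natCast.1 hw
  by_contra h
  exact absurd (one_le_pow₀ (not_lt.1 h) (n := k)) (not_le.2 (h1.trans h2))

theorem one_sub_ne_zero_of_norm_lt {u : ℂ} (hu : ‖u‖ < 1) : 1 - u ≠ 0 := by
  intro h
  rw [sub_eq_zero] at h
  rw [← h, norm_one] at hu
  exact lt_irrefl _ hu

theorem differentiableAt_hartogsKernel {k : ℕ} (hk : k ≠ 0) {z w : ℂ × ℂ}
    (hz : z ∈ hartogsTriangle (k : ℝ)) (hw : w ∈ hartogsTriangle (k : ℝ)) :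
    DifferentiableAt ℂ (fun z => hartogsKernel k z w) z := by
  have ht : z.2 * conj w.2 ≠ 0 := mul_ne_zero (snd_ne_zero_of_mem_hartogsTriangle hz)
    (by simpa using snd_ne_zero_of_mem_hartogsTriangle hw)
  have hu : 1 - (z.1 * conj w.1) ^ k / (z.2 * conj w.2) ≠ 0 :=
    one_sub_ne_zero_of_norm_lt ((norm_ratio_le hz).trans_lt (ratio_lt_one hw))
  have ht1 : 1 - z.2 * conj w.2 ≠ 0 :=
    one_sub_ne_zero_of_norm_lt ((norm_snd_mul_le hz).trans_lt
      (mem_hartogsTriangle_natCast.1 hw).2)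
  have hs : DifferentiableAt ℂ (fun z : ℂ × ℂ => z.1 * conj w.1) z := by fun_prop
  have htd : DifferentiableAt ℂ (fun z : ℂ × ℂ => z.2 * conj w.2) z := by fun_prop
  have hr : DifferentiableAt ℂ
      (fun z : ℂ × ℂ => (z.1 * conj w.1) ^ k / (z.2 * conj w.2)) z :=
    (hs.fun_pow k).fun_mul (htd.fun_inv ht)
  have hm : ∀ A B, DifferentiableAt ℂ
      (fun z : ℂ × ℂ => averagedMonomial k (z.1 * conj w.1) (z.2 * conj w.2) A B) z := by
    intro A B
    unfold averagedMonomial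
    split_ifs
    · exact hs.pow A
    · exact (hs.pow B).mul hr
    · exact (hs.pow A).mul htd
    · exact differentiableAt_const 0
  have hkc : (k : ℂ) ≠ 0 := by exact_mod_cast hk
  have hpi : (π : ℂ) ≠ 0 := by exact_mod_cast Real.pi_ne_zero
  unfold hartogsKernel kernelFun kernelNumerator
  refine (DifferentiableAt.fun_sum fun τ _ => hm _ _).fun_mul (DifferentiableAt.fun_inv ?_ ?_)
  · exact ((htd.const_mul _).mul ((hr.const_sub 1).pow 2)).mul ((htd.const_sub 1).pow 2)
  · exact mul_ne_zero (mul_ne_zero (mul_ne_zero (mul_ne_zero (pow_ne_zero 2 hpi) hkc) ht)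
      (pow_ne_zero 2 hu)) (pow_ne_zero 2 ht1)

theorem norm_averagedMonomial_le {k : ℕ} {s t : ℂ} (hs : ‖s‖ ≤ 1) (ht : ‖t‖ ≤ 1)
    (hu : ‖s ^ k / t‖ ≤ 1) (A B : ℕ) : ‖averagedMonomial k s t A B‖ ≤ 1 := by
  have hp : ∀ n : ℕ, ‖s ^ n‖ ≤ 1 := fun n => by
    rw [norm_pow]; exact pow_le_one₀ (norm_nonneg _) hs
  unfold averagedMonomial
  split_ifs
  · exact hp A
  · rw [norm_mul]; exact mul_le_one₀ (hp B) (norm_nonneg _) hu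
  · rw [norm_mul]; exact mul_le_one₀ (hp A) (norm_nonneg _) ht
  · simp

theorem inv_norm_one_sub_sq_le {u : ℂ} {c : ℝ} (hu : ‖u‖ ≤ c) (hc : c < 1) :
    ‖((1 - u) ^ 2)⁻¹‖ ≤ ((1 - c) ^ 2)⁻¹ := by
  have h1 := norm_sub_norm_le (1 : ℂ) u
  rw [norm_one] at h1
  have h0 : 0 < 1 - c := by linarith
  rw [norm_inv, norm_pow]
  gcongr
  linarith

/-- The factor 1/t prevents a bound on the kernel itself; multiplying by z₂ removes it, and the
Jacobian of the covering supplies that z₂. -/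
theorem exists_bound_snd_mul_hartogsKernel {k : ℕ} {w : ℂ × ℂ}
    (hw : w ∈ hartogsTriangle (k : ℝ)) :
    ∃ C : ℝ, ∀ z ∈ hartogsTriangle (k : ℝ), ‖z.2 * hartogsKernel k z w‖ ≤ C := by
  refine ⟨(kernelIndex k).card * ‖((π : ℂ) ^ 2 * k * conj w.2)⁻¹‖ *
    ((1 - ‖w.1‖ ^ k / ‖w.2‖) ^ 2)⁻¹ * ((1 - ‖w.2‖) ^ 2)⁻¹, fun z hz => ?_⟩
  have hz0 := snd_ne_zero_of_mem_hartogsTriangle hz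
  have hw2 := (mem_hartogsTriangle_natCast.1 hw).2
  have hnum : ‖kernelNumerator k (z.1 * conj w.1) (z.2 * conj w.2)‖ ≤ (kernelIndex k).card := by
    unfold kernelNumerator
    refine (norm_sum_le_of_le _ fun τ _ => norm_averagedMonomial_le ?_
      ((norm_snd_mul_le hz).trans hw2.le) ((norm_ratio_le hz).trans (ratio_lt_one hw).le)
      _ _).trans (by simp)
    rw [norm_mul, RCLike.norm_conj]
    exact mul_le_one₀ (norm_fst_lt_one hz).le (norm_nonneg _) (norm_fst_lt_one hw).le
  have heq : z.2 * hartogsKernel k z w =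
      kernelNumerator k (z.1 * conj w.1) (z.2 * conj w.2) * ((π : ℂ) ^ 2 * k * conj w.2)⁻¹ *
        ((1 - (z.1 * conj w.1) ^ k / (z.2 * conj w.2)) ^ 2)⁻¹ *
        ((1 - z.2 * conj w.2) ^ 2)⁻¹ := by
    rw [hartogsKernel, kernelFun, div_eq_mul_inv]
    simp only [mul_inv]
    linear_combination (kernelNumerator k (z.1 * conj w.1) (z.2 * conj w.2) *
      ((π : ℂ) ^ 2)⁻¹ * (k : ℂ)⁻¹ * (conj w.2)⁻¹ *
        ((1 - (z.1 * conj w.1) ^ k * (z.2⁻¹ * (conj w.2)⁻¹)) ^ 2)⁻¹ *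
        ((1 - z.2 * conj w.2) ^ 2)⁻¹) * mul_inv_cancel₀ hz0
  rw [heq, norm_mul, norm_mul, norm_mul]
  gcongr
  · exact inv_norm_one_sub_sq_le (norm_ratio_le hz) (ratio_lt_one hw)
  · exact inv_norm_one_sub_sq_le (norm_snd_mul_le hz) hw2

/-- The kernel is in the Bergman space in its first variable. -/
theorem memBergman_hartogsKernel {k : ℕ} (hk : k ≠ 0) {w : ℂ × ℂ}
    (hw : w ∈ hartogsTriangle (k : ℝ)) :
    MemBergman (hartogsTriangle (k : ℝ)) (fun z => hartogsKernel k z w) := by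
  have hd : DifferentiableOn ℂ (fun z => hartogsKernel k z w) (hartogsTriangle (k : ℝ)) :=
    fun z hz => (differentiableAt_hartogsKernel hk hz hw).differentiableWithinAt
  refine ⟨hd, memLp_two_of_lintegral (hd.continuousOn.aestronglyMeasurable
    (isOpen_hartogsTriangle_natCast k).measurableSet) ?_⟩
  obtain ⟨C, hC⟩ := exists_bound_snd_mul_hartogsKernel hw
  have h := lintegral_hartogsCover hk (fun z => ‖hartogsKernel k z w‖ₑ ^ 2)
  -- Upstairs |z₂| = |p₂|ᵏ, so the Jacobian weight is k²|z₂|² and the integrand is at most k²C² on a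
  -- space of finite measure.
  have hle : ∫⁻ p in discProd, ENNReal.ofReal (k ^ 2 * ‖p.2‖ ^ (2 * k)) *
      ‖hartogsKernel k (hartogsCover k p) w‖ₑ ^ 2 ≤
      ∫⁻ _ in discProd, ENNReal.ofReal (k ^ 2 * C ^ 2) := by
    refine setLIntegral_mono' isOpen_discProd.measurableSet fun p hp => ?_
    rw [← ofReal_norm, ← ENNReal.ofReal_pow (norm_nonneg _),
      ← ENNReal.ofReal_mul (by positivity)]
    apply ENNReal.ofReal_le_ofReal
    have := hC _ (hartogsCover_mem hk hp)
    rw [norm_mul, show ‖(hartogsCover k p).2‖ = ‖p.2‖ ^ k by simp [hartogsCover]] at this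
    calc _ = (k : ℝ) ^ 2 * (‖p.2‖ ^ k * ‖hartogsKernel k (hartogsCover k p) w‖) ^ 2 := by ring
      _ ≤ _ := by gcongr
  rw [h] at hle
  have hlt := hle.trans_lt (show _ < ⊤ by
    rw [lintegral_const]
    exact ENNReal.mul_lt_top ENNReal.ofReal_lt_top (measure_lt_top _ _))
  by_contra htop
  rw [not_lt, top_le_iff] at htop
  rw [htop, ENNReal.mul_top (by exact_mod_cast hk)] at hlt
  exact lt_irrefl _ hlt

/-! ### Pullback, averaging over deck rotations, and the reproducing property -/

/-- The pullback of a function on the Hartogs triangle, with the Jacobian factor. -/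
def hartogsPullback (k : ℕ) (f : ℂ × ℂ → ℂ) (q : ℂ × ℂ) : ℂ := f (hartogsCover k q) * q.2 ^ k

theorem differentiableOn_hartogsPullback {k : ℕ} (hk : k ≠ 0) {f : ℂ × ℂ → ℂ}
    (hf : MemBergman (hartogsTriangle (k : ℝ)) f) :
    DifferentiableOn ℂ (hartogsPullback k f) discProd :=
  (hf.1.comp (fun p _ => (hasFDerivAt_hartogsCover k p).differentiableAt.differentiableWithinAt)
    fun _ hp => hartogsCover_mem hk hp).fun_mul (by fun_prop)

theorem memLp_hartogsPullback {k : ℕ} (hk : k ≠ 0) {f : ℂ × ℂ → ℂ}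
    (hf : MemBergman (hartogsTriangle (k : ℝ)) f) :
    MemLp (hartogsPullback k f) 2 (volume.restrict discProd) := by
  refine memLp_two_of_lintegral
    ((differentiableOn_hartogsPullback hk hf).continuousOn.aestronglyMeasurable
      isOpen_discProd.measurableSet) ?_
  have h := lintegral_hartogsCover hk (fun z => ‖f z‖ₑ ^ 2)
  have hle : ∫⁻ p in discProd, ‖hartogsPullback k f p‖ₑ ^ 2 ≤
      ∫⁻ p in discProd, ENNReal.ofReal (k ^ 2 * ‖p.2‖ ^ (2 * k)) *
        ‖f (hartogsCover k p)‖ₑ ^ 2 := by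
    refine lintegral_mono fun p => ?_
    simp only
    rw [← ofReal_norm, ← ofReal_norm, ← ENNReal.ofReal_pow (norm_nonneg _),
      ← ENNReal.ofReal_pow (norm_nonneg _), ← ENNReal.ofReal_mul (by positivity)]
    apply ENNReal.ofReal_le_ofReal
    have hk1 : (1 : ℝ) ≤ (k : ℝ) ^ 2 :=
      one_le_pow₀ (by exact_mod_cast Nat.one_le_iff_ne_zero.2 hk)
    calc _ = 1 * (‖p.2‖ ^ (2 * k) * ‖f (hartogsCover k p)‖ ^ 2) := by
          rw [hartogsPullback, norm_mul, norm_pow]; ring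
      _ ≤ (k : ℝ) ^ 2 * (‖p.2‖ ^ (2 * k) * ‖f (hartogsCover k p)‖ ^ 2) := by gcongr
      _ = _ := by ring
  rw [h] at hle
  exact hle.trans_lt (ENNReal.mul_lt_top (ENNReal.natCast_lt_top k)
    (lintegral_enorm_sq_lt_top hf.2))

theorem hartogsPullback_deckRotation {k : ℕ} {c : Circle} (hc : (c : ℂ) ^ k = 1)
    (f : ℂ × ℂ → ℂ) (q : ℂ × ℂ) :
    hartogsPullback k f (deckRotation c q) = hartogsPullback k f q := by
  rw [hartogsPullback, hartogsCover_deckRotation hc, hartogsPullback]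
  simp only [deckRotation, mul_pow, hc, one_mul]

/-- The part of the integrand that is invariant under deck rotations. -/
noncomputable def invariantFactor (k : ℕ) (f : ℂ × ℂ → ℂ) (p q : ℂ × ℂ) : ℂ :=
  ((1 - (p.1 * conj q.1) ^ k) ^ 2)⁻¹ * ((1 - (p.2 * conj q.2) ^ k) ^ 2)⁻¹ * hartogsPullback k f q

theorem deckRotation_conj_fst (c : Circle) (q : ℂ × ℂ) :
    conj (deckRotation c q).1 = c * conj q.1 := by
  have h : conj ((c : ℂ)⁻¹) = c := by
    rw [← Circle.coe_inv, ← Circle.coe_inv_eq_conj, inv_inv]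
  simp [deckRotation, -map_inv₀, h]

theorem deckRotation_conj_snd (c : Circle) (q : ℂ × ℂ) :
    conj (deckRotation c q).2 = (c : ℂ)⁻¹ * conj q.2 := by
  simp [deckRotation, ← Circle.coe_inv_eq_conj]

theorem invariantFactor_deckRotation {k : ℕ} {c : Circle} (hc : (c : ℂ) ^ k = 1)
    (f : ℂ × ℂ → ℂ) (p q : ℂ × ℂ) :
    invariantFactor k f p (deckRotation c q) = invariantFactor k f p q := by
  simp only [invariantFactor, hartogsPullback_deckRotation hc, deckRotation_conj_fst,
    deckRotation_conj_snd, mul_pow, inv_pow, hc, inv_one, one_mul]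

theorem norm_mul_conj_le_one {a b : ℂ} (ha : ‖a‖ < 1) (hb : ‖b‖ < 1) : ‖a * conj b‖ ≤ 1 := by
  rw [norm_mul, RCLike.norm_conj]
  exact mul_le_one₀ ha.le (norm_nonneg _) hb.le

theorem integrable_invariantFactor_mul {k : ℕ} (hk : k ≠ 0) {f : ℂ × ℂ → ℂ}
    (hf : MemBergman (hartogsTriangle (k : ℝ)) f) {p : ℂ × ℂ} (hp : p ∈ discProd) (A B : ℕ) :
    IntegrableOn (fun q => invariantFactor k f p q * ((p.1 * conj q.1) ^ A *
      (p.2 * conj q.2) ^ B)) discProd := by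
  have hF : Integrable (hartogsPullback k f) (volume.restrict discProd) :=
    (memLp_hartogsPullback hk hf).integrable one_le_two
  obtain ⟨ha, hb, -⟩ := mem_discProd.1 hp
  have hpow : ∀ {x : ℂ}, ‖x‖ < 1 → ‖x ^ k‖ < 1 := fun hx => by
    rw [norm_pow]; exact pow_lt_one₀ (norm_nonneg _) hx hk
  have h := hF.bdd_mul (f := fun q : ℂ × ℂ => ((1 - (p.1 * conj q.1) ^ k) ^ 2)⁻¹ *
      ((1 - (p.2 * conj q.2) ^ k) ^ 2)⁻¹ * ((p.1 * conj q.1) ^ A * (p.2 * conj q.2) ^ B))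
    (c := ((1 - ‖p.1 ^ k‖) ^ 2)⁻¹ * ((1 - ‖p.2 ^ k‖) ^ 2)⁻¹ * (1 * 1)) ?_ ?_
  · refine h.congr (ae_of_all _ fun q => ?_)
    simp only [invariantFactor]
    ring
  · exact Measurable.aestronglyMeasurable (by fun_prop)
  · filter_upwards [ae_restrict_mem isOpen_discProd.measurableSet] with q hq
    obtain ⟨h1, h2, -⟩ := mem_discProd.1 hq
    have hx : ∀ n : ℕ, ‖(p.1 * conj q.1) ^ n‖ ≤ 1 := fun n => by
      rw [norm_pow]; exact pow_le_one₀ (norm_nonneg _) (norm_mul_conj_le_one ha h1)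
    have hy : ∀ n : ℕ, ‖(p.2 * conj q.2) ^ n‖ ≤ 1 := fun n => by
      rw [norm_pow]; exact pow_le_one₀ (norm_nonneg _) (norm_mul_conj_le_one hb h2)
    have e1 := norm_bergman_disc_le (hpow ha) (hpow h1)
    have e2 := norm_bergman_disc_le (hpow hb) (hpow h2)
    rw [map_pow, ← mul_pow] at e1 e2
    rw [norm_mul, norm_mul, norm_mul]
    have h1' := hx A
    have h2' := hy B
    gcongr

/-- A monomial that is not invariant under deck rotations integrates to zero. -/
theorem integral_invariantFactor_mul_eq_zero {k : ℕ} (hk : k ≠ 0) (f : ℂ × ℂ → ℂ)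
    (p : ℂ × ℂ) {A B : ℕ} (hAB : ¬ A ≡ B [MOD k]) :
    ∫ q in discProd, invariantFactor k f p q * ((p.1 * conj q.1) ^ A * (p.2 * conj q.2) ^ B) =
      0 := by
  set c := circleRoot k with hc
  have hprim : IsPrimitiveRoot (c : ℂ) k := isPrimitiveRoot_circleRoot hk
  have hc0 : (c : ℂ) ≠ 0 := c.coe_ne_zero
  set I := ∫ q in discProd,
    invariantFactor k f p q * ((p.1 * conj q.1) ^ A * (p.2 * conj q.2) ^ B) with hI
  have e := (measurePreserving_deckRotation c).setIntegral_preimage_emb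
    (measurableEmbedding_deckRotation c)
    (fun q => invariantFactor k f p q * ((p.1 * conj q.1) ^ A * (p.2 * conj q.2) ^ B)) discProd
  have hpre : deckRotation c ⁻¹' discProd = discProd := by
    ext q
    exact deckRotation_mem_discProd c
  rw [hpre] at e
  -- Rotating q multiplies the integrand by cᴬ c⁻ᴮ while the integral is unchanged. As c is a
  -- primitive k-th root of unity, a nonzero integral would force A ≡ B mod k.
  have hrot : ∀ q : ℂ × ℂ, invariantFactor k f p (deckRotation c q) *
      ((p.1 * conj (deckRotation c q).1) ^ A * (p.2 * conj (deckRotation c q).2) ^ B) =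
      ((c : ℂ) ^ A * ((c : ℂ) ^ B)⁻¹) *
        (invariantFactor k f p q * ((p.1 * conj q.1) ^ A * (p.2 * conj q.2) ^ B)) := by
    intro q
    rw [invariantFactor_deckRotation hprim.pow_eq_one, deckRotation_conj_fst,
      deckRotation_conj_snd]
    simp only [mul_pow, inv_pow]
    ring
  simp only [hrot] at e
  rw [integral_const_mul, ← hI] at e
  by_contra hne
  have h1 : (c : ℂ) ^ A * ((c : ℂ) ^ B)⁻¹ = 1 := mul_right_cancel₀ hne (by rw [e, one_mul])
  have h2 : (c : ℂ) ^ A = (c : ℂ) ^ B := by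
    rwa [mul_inv_eq_one₀ (pow_ne_zero B hc0)] at h1
  have h3 : c ^ A = c ^ B := Circle.ext (by rw [Circle.coe_pow, Circle.coe_pow, h2])
  have h4 : orderOf c = k := by
    rw [hprim.eq_orderOf]
    exact (orderOf_injective Circle.coeHom Circle.coe_injective c).symm
  rw [pow_eq_pow_iff_modEq, h4] at h3
  exact hAB h3

theorem modEq_cases {k A B : ℕ} (hA : A < 2 * k) (hB : B < 2 * k) (h : A ≡ B [MOD k]) :
    A = B ∨ A = B + k ∨ B = A + k := by
  have hk : 0 < k := by omega
  have h1 := Nat.div_add_mod A k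
  have h2 := Nat.div_add_mod B k
  have h3 : A / k < 2 := Nat.div_lt_of_lt_mul (by omega)
  have h4 : B / k < 2 := Nat.div_lt_of_lt_mul (by omega)
  have h5 : A % k = B % k := h
  interval_cases A / k <;> interval_cases B / k <;> omega

/-- Exponents below 2k congruent mod k differ by 0 or ±k. The three nonzero branches of
`averagedMonomial` are then xᴬyᴮ rewritten through xy = s, yᵏ = t, xᵏ = sᵏ/t. -/
theorem averagedMonomial_spec {k : ℕ} (hk : k ≠ 0) {f : ℂ × ℂ → ℂ}
    (hf : MemBergman (hartogsTriangle (k : ℝ)) f) {p : ℂ × ℂ} (hp : p ∈ discProd) {A B : ℕ}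
    (hA : A < 2 * k) (hB : B < 2 * k) :
    IntegrableOn (fun q => invariantFactor k f p q * averagedMonomial k
      ((p.1 * p.2) * conj (q.1 * q.2)) (p.2 ^ k * conj (q.2 ^ k)) A B) discProd ∧
    ∫ q in discProd, invariantFactor k f p q * averagedMonomial k
      ((p.1 * p.2) * conj (q.1 * q.2)) (p.2 ^ k * conj (q.2 ^ k)) A B =
    ∫ q in discProd, invariantFactor k f p q *
      ((p.1 * conj q.1) ^ A * (p.2 * conj q.2) ^ B) := by
  by_cases h : A ≡ B [MOD k]
  · have heq : ∀ q ∈ discProd, invariantFactor k f p q * averagedMonomial k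
        ((p.1 * p.2) * conj (q.1 * q.2)) (p.2 ^ k * conj (q.2 ^ k)) A B =
        invariantFactor k f p q * ((p.1 * conj q.1) ^ A * (p.2 * conj q.2) ^ B) := by
      intro q hq
      have hp2 := (mem_discProd.1 hp).2.2
      have hq2 : conj q.2 ≠ 0 := by simpa using (mem_discProd.1 hq).2.2
      congr 1
      unfold averagedMonomial
      simp only [map_mul, map_pow]
      rcases modEq_cases hA hB h with rfl | rfl | rfl
      · rw [if_pos rfl]; ring
      · rw [if_neg (by omega), if_pos rfl]
        field_simp
        ring
      · rw [if_neg (by omega), if_neg (by omega), if_pos rfl]; ring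
    exact ⟨(integrable_invariantFactor_mul hk hf hp A B).congr_fun
      (fun q hq => (heq q hq).symm) isOpen_discProd.measurableSet,
      setIntegral_congr_fun isOpen_discProd.measurableSet heq⟩
  · have hz : ∀ s t : ℂ, averagedMonomial k s t A B = 0 := by
      intro s t
      unfold averagedMonomial
      rw [if_neg, if_neg, if_neg]
      · rintro rfl
        exact h (by simp [Nat.ModEq])
      · rintro rfl
        exact h (by simp [Nat.ModEq])
      · rintro rfl
        exact h rfl
    rw [integral_invariantFactor_mul_eq_zero hk f p h]
    simp only [hz, mul_zero]
    exact ⟨integrableOn_zero, integral_zero _ _⟩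

/-- Trades the denominator for a deck-invariant one, at the cost of a polynomial factor. -/
theorem inv_one_sub_sq_eq {k : ℕ} {x : ℂ} (hx : ‖x‖ < 1) (hk : k ≠ 0) :
    ((1 - x) ^ 2)⁻¹ = ((1 - x ^ k) ^ 2)⁻¹ * (∑ i ∈ Finset.range k, x ^ i) ^ 2 := by
  have h1 : 1 - x ≠ 0 := one_sub_ne_zero_of_norm_lt hx
  have h2 : 1 - x ^ k ≠ 0 := one_sub_ne_zero_of_norm_lt (by
    rw [norm_pow]; exact pow_lt_one₀ (norm_nonneg _) hx hk)
  have h3 := geom_sum_mul_neg x k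
  have h4 : ∑ i ∈ Finset.range k, x ^ i ≠ 0 := by
    intro h
    rw [h, zero_mul] at h3
    exact h2 h3.symm
  rw [← h3]
  field_simp

theorem sum_kernelIndex (k : ℕ) (x y : ℂ) :
    ∑ τ ∈ kernelIndex k, x ^ (τ.1.1 + τ.1.2) * y ^ (τ.2.1 + τ.2.2) =
      (∑ i ∈ Finset.range k, x ^ i) ^ 2 * (∑ i ∈ Finset.range k, y ^ i) ^ 2 := by
  have e : ∀ u : ℂ, (∑ i ∈ Finset.range k, u ^ i) ^ 2 =
      ∑ σ ∈ Finset.range k ×ˢ Finset.range k, u ^ (σ.1 + σ.2) := by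
    intro u
    rw [sq, Finset.sum_mul_sum, Finset.sum_product]
    simp only [pow_add]
  rw [e x, e y, Finset.sum_mul_sum, kernelIndex, Finset.sum_product]

/-- Averaging the reproducing formula on `discProd` over deck rotations. -/
theorem integral_invariantFactor_mul_kernelNumerator {k : ℕ} (hk : k ≠ 0) {f : ℂ × ℂ → ℂ}
    (hf : MemBergman (hartogsTriangle (k : ℝ)) f) {p : ℂ × ℂ} (hp : p ∈ discProd) :
    IntegrableOn (fun q => invariantFactor k f p q * kernelNumerator k
      ((p.1 * p.2) * conj (q.1 * q.2)) (p.2 ^ k * conj (q.2 ^ k))) discProd ∧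
    ∫ q in discProd, invariantFactor k f p q * kernelNumerator k
      ((p.1 * p.2) * conj (q.1 * q.2)) (p.2 ^ k * conj (q.2 ^ k)) =
    π ^ 2 * hartogsPullback k f p := by
  have hspec : ∀ τ ∈ kernelIndex k, _ := fun τ hτ =>
    averagedMonomial_spec hk hf hp (A := τ.1.1 + τ.1.2) (B := τ.2.1 + τ.2.2)
      (by simp only [kernelIndex, Finset.mem_product, Finset.mem_range] at hτ; omega)
      (by simp only [kernelIndex, Finset.mem_product, Finset.mem_range] at hτ; omega)
  simp only [kernelNumerator, Finset.mul_sum]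
  refine ⟨integrable_finsetSum _ fun τ hτ => (hspec τ hτ).1, ?_⟩
  rw [integral_finsetSum _ fun τ hτ => (hspec τ hτ).1,
    Finset.sum_congr rfl fun τ hτ => (hspec τ hτ).2,
    ← integral_finsetSum _ fun τ _ => integrable_invariantFactor_mul hk hf hp _ _,
    ← discProd_reproducing (differentiableOn_hartogsPullback hk hf)
      (memLp_hartogsPullback hk hf) hp]
  refine setIntegral_congr_fun isOpen_discProd.measurableSet fun q hq => ?_
  obtain ⟨ha, hb, -⟩ := mem_discProd.1 hp
  obtain ⟨h1, h2, -⟩ := mem_discProd.1 hq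
  have hx : ‖p.1 * conj q.1‖ < 1 := by
    rw [norm_mul, RCLike.norm_conj]
    exact mul_lt_one_of_nonneg_of_lt_one_left (norm_nonneg _) ha h1.le
  have hy : ‖p.2 * conj q.2‖ < 1 := by
    rw [norm_mul, RCLike.norm_conj]
    exact mul_lt_one_of_nonneg_of_lt_one_left (norm_nonneg _) hb h2.le
  rw [← Finset.mul_sum, sum_kernelIndex, inv_one_sub_sq_eq hx hk, inv_one_sub_sq_eq hy hk,
    invariantFactor]
  ring

/-- Upstairs sᵏ/t = xᵏ and t = yᵏ, so the denominators match those of `invariantFactor`. In |q₂|²ᵏ =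
q₂ᵏ q̄₂ᵏ the first factor goes to the pullback and the second cancels against 1/t, leaving 1/p₂ᵏ. -/
theorem jacobian_mul_hartogsKernel {k : ℕ} (hk : k ≠ 0) (f : ℂ × ℂ → ℂ) {p q : ℂ × ℂ}
    (hp : p ∈ discProd) (hq : q ∈ discProd) :
    ((k ^ 2 * ‖q.2‖ ^ (2 * k) : ℝ) : ℂ) *
      (hartogsKernel k (hartogsCover k p) (hartogsCover k q) * f (hartogsCover k q)) =
    (k / (π ^ 2 * p.2 ^ k)) * (invariantFactor k f p q * kernelNumerator k
      ((p.1 * p.2) * conj (q.1 * q.2)) (p.2 ^ k * conj (q.2 ^ k))) := by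
  have hp2 := (mem_discProd.1 hp).2.2
  have hq2 := (mem_discProd.1 hq).2.2
  have hq2' : conj q.2 ≠ 0 := by simpa using hq2
  have hkc : (k : ℂ) ≠ 0 := by exact_mod_cast hk
  have hpi : (π : ℂ) ≠ 0 := by exact_mod_cast Real.pi_ne_zero
  have hn : ((‖q.2‖ : ℂ)) ^ (2 * k) = q.2 ^ k * conj q.2 ^ k := by
    rw [pow_mul, ← mul_pow, mul_conj, normSq_eq_norm_sq]
    push_cast
    rfl
  have hu : ((p.1 * p.2) * conj (q.1 * q.2)) ^ k / (p.2 ^ k * conj (q.2 ^ k)) =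
      (p.1 * conj q.1) ^ k := by
    simp only [map_mul, map_pow]
    field_simp
    ring
  have ht : p.2 ^ k * conj (q.2 ^ k) = (p.2 * conj q.2) ^ k := by
    rw [map_pow, mul_pow]
  simp only [hartogsKernel, kernelFun, hartogsCover]
  rw [hu]
  generalize kernelNumerator k ((p.1 * p.2) * conj (q.1 * q.2)) (p.2 ^ k * conj (q.2 ^ k)) = N
  rw [invariantFactor, hartogsPullback, ht, hartogsCover]
  push_cast
  rw [hn, mul_pow p.2 (conj q.2) k]
  generalize ((1 - (p.1 * conj q.1) ^ k) ^ 2) = X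
  generalize ((1 - p.2 ^ k * conj q.2 ^ k) ^ 2) = Y
  have h1 : p.2 ^ k ≠ 0 := pow_ne_zero _ hp2
  have h2 : conj q.2 ^ k ≠ 0 := pow_ne_zero _ hq2'
  generalize p.2 ^ k = u at *
  generalize conj q.2 ^ k = v at *
  simp only [div_eq_mul_inv, mul_inv]
  field_simp

/-- The Bergman kernel of the Hartogs triangle of integer exponent. -/
theorem isBergmanKernel_hartogsKernel {k : ℕ} (hk : k ≠ 0) :
    IsBergmanKernel (hartogsTriangle (k : ℝ)) (hartogsKernel k) where
  mem w hw := memBergman_hartogsKernel hk hw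
  conj_symm z _ w _ := hartogsKernel_conj_symm k z w
  reproducing f hf z hz := by
    have hz' := hz
    rw [← image_hartogsCover hk] at hz'
    obtain ⟨p, hp, rfl⟩ := hz'
    have hpU := hartogsSector_subset k hp
    have hp2 : p.2 ^ k ≠ 0 := pow_ne_zero _ (mem_discProd.1 hpU).2.2
    have hkc : (k : ℂ) ≠ 0 := by exact_mod_cast hk
    have hpi : (π : ℂ) ≠ 0 := by exact_mod_cast Real.pi_ne_zero
    obtain ⟨hint, hval⟩ := integral_invariantFactor_mul_kernelNumerator hk hf hpU
    have hcongr := fun q hq => jacobian_mul_hartogsKernel hk f hpU (q := q) hq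
    have h := integral_hartogsCover hk
      (fun w => hartogsKernel k (hartogsCover k p) w * f w)
      (IntegrableOn.congr_fun (hint.const_mul _) (fun q hq => (hcongr q hq).symm)
        isOpen_discProd.measurableSet)
    rw [setIntegral_congr_fun isOpen_discProd.measurableSet hcongr, integral_const_mul, hval,
      hartogsPullback] at h
    refine mul_left_cancel₀ hkc (Eq.trans ?_ h)
    field_simp

/-! ### Zeros of the numerator -/

theorem averagedMonomial_zero {k : ℕ} (hk : k ≠ 0) (t : ℂ) (A B : ℕ) :
    averagedMonomial k 0 t A B =
      (if A = 0 then 1 else 0) * ((if B = 0 then 1 else 0) + if B = k then t else 0) := by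
  unfold averagedMonomial
  rcases Nat.eq_zero_or_pos A with rfl | hA
  · by_cases h0 : B = 0
    · subst h0
      simp [hk.symm]
    · have h1 : ¬ (0 = B) := fun h => h0 h.symm
      have h2 : ¬ (0 = B + k) := by omega
      simp [h0, h1, h2]
  · have hA0 : A ≠ 0 := hA.ne'
    simp [hA0, hk]

/-- The number of pairs of natural numbers less than `k` with sum `k`. -/
def antidiagonalCount (k : ℕ) : ℕ :=
  ((Finset.range k ×ˢ Finset.range k).filter fun σ : ℕ × ℕ => σ.1 + σ.2 = k).card

/-- The pairs (1, k-1) and (k-1, 1) are distinct once k ≥ 3; they coincide for k = 2, which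
therefore needs separate treatment. -/
theorem two_le_antidiagonalCount {k : ℕ} (hk : 3 ≤ k) : 2 ≤ antidiagonalCount k := by
  have hsub : ({(1, k - 1), (k - 1, 1)} : Finset (ℕ × ℕ)) ⊆
      (Finset.range k ×ˢ Finset.range k).filter fun σ : ℕ × ℕ => σ.1 + σ.2 = k := by
    intro σ hσ
    simp only [Finset.mem_insert, Finset.mem_singleton] at hσ
    simp only [Finset.mem_filter, Finset.mem_product, Finset.mem_range]
    rcases hσ with rfl | rfl <;> simp only <;> omega
  have h := Finset.card_le_card hsub
  rwa [Finset.card_pair (by simp only [ne_eq, Prod.mk.injEq]; omega)] at h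

theorem kernelNumerator_zero {k : ℕ} (hk : k ≠ 0) (t : ℂ) :
    kernelNumerator k 0 t = 1 + antidiagonalCount k * t := by
  have h0 : ((Finset.range k ×ˢ Finset.range k).filter fun σ : ℕ × ℕ => σ.1 + σ.2 = 0) =
      {(0, 0)} := by
    ext ⟨i, j⟩
    simp only [Finset.mem_filter, Finset.mem_product, Finset.mem_range, Finset.mem_singleton,
      Prod.mk.injEq]
    omega
  simp only [kernelNumerator, averagedMonomial_zero hk, kernelIndex]
  rw [Finset.sum_product]
  refine (Finset.sum_mul_sum _ _ (fun σ : ℕ × ℕ => if σ.1 + σ.2 = 0 then (1 : ℂ) else 0)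
    (fun σ : ℕ × ℕ => (if σ.1 + σ.2 = 0 then (1 : ℂ) else 0) +
      if σ.1 + σ.2 = k then t else 0)).symm.trans ?_
  rw [Finset.sum_add_distrib, ← Finset.sum_filter, ← Finset.sum_filter, h0,
    Finset.sum_singleton, Finset.sum_const, nsmul_eq_mul, one_mul, antidiagonalCount]

theorem kernelNumerator_two (s t : ℂ) :
    kernelNumerator 2 s t = 1 + 4 * s + s ^ 2 + t + s ^ 2 / t := by
  simp only [kernelNumerator, kernelIndex, Finset.sum_product, Finset.sum_range_succ,
    Finset.sum_range_zero, averagedMonomial]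
  norm_num
  ring

/-- The Bergman kernel of the Hartogs triangle of integer exponent at least two has a zero. -/
theorem exists_hartogsKernel_eq_zero {k : ℕ} (hk : 2 ≤ k) :
    ∃ z ∈ hartogsTriangle (k : ℝ), ∃ w ∈ hartogsTriangle (k : ℝ), hartogsKernel k z w = 0 := by
  rcases hk.eq_or_lt with rfl | hk3
  -- At s = -1/4 the terms 1 + 4s cancel, and t times the numerator is t² + t/16 + 1/16. Its roots
  -- are complex conjugates with product 1/16, so |t| = 1/4.
  · set t : ℂ := (-1 + Real.sqrt 63 * I) / 32 with ht
    have hsq : ((Real.sqrt 63 : ℝ) : ℂ) ^ 2 = 63 := by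
      rw [← ofReal_pow, Real.sq_sqrt (by norm_num)]
      norm_num
    have hquad : t ^ 2 + t / 16 + 1 / 16 = 0 := by
      rw [ht]
      linear_combination (I ^ 2 / 1024) * hsq + (63 / 1024) * I_sq
    have ht0 : t ≠ 0 := by
      intro h
      rw [h] at hquad
      norm_num at hquad
    have hnorm : ‖t‖ = 1 / 4 := by
      have h1 : normSq t = 1 / 16 := by
        rw [ht, map_div₀, normSq_apply]
        simp
        norm_num
      rw [← sq_eq_sq₀ (norm_nonneg _) (by norm_num), ← normSq_eq_norm_sq, h1]
      norm_num
    -- These points realize s = -1/4 and the chosen t; both have first modulus 1/2 and second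
    -- modulus 1/2, and 1/4 < 1/2 < 1.
    refine ⟨(-1 / 2, 2 * t), ?_, (1 / 2, 1 / 2), ?_, ?_⟩
    · rw [mem_hartogsTriangle_natCast]
      simp only [norm_mul, hnorm]
      norm_num
    · rw [mem_hartogsTriangle_natCast]
      norm_num
    · have e1 : (-1 / 2 : ℂ) * conj (1 / 2 : ℂ) = -1 / 4 := by
        simp only [map_div₀, map_one, map_ofNat]; norm_num
      have e2 : 2 * t * conj (1 / 2 : ℂ) = t := by
        simp only [map_div₀, map_one, map_ofNat]; ring
      simp only [hartogsKernel, e1, e2, kernelFun]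
      rw [kernelNumerator_two, div_eq_zero_iff]
      left
      field_simp
      linear_combination 16 * hquad
  · have hk0 : k ≠ 0 := by omega
    have hN := two_le_antidiagonalCount hk3
    set N := antidiagonalCount k with hNdef
    have hN' : (2 : ℝ) ≤ N := by exact_mod_cast hN
    have hNc : (N : ℂ) ≠ 0 := by
      have : N ≠ 0 := by omega
      exact_mod_cast this
    -- The second coordinates multiply to -1/N, the root of 1 + Nt; N ≥ 2 gives 4/(3N) ≤ 2/3 < 1.
    refine ⟨(0, -(4 / (3 * N))), ?_, (0, 3 / 4), ?_, ?_⟩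
    · rw [mem_hartogsTriangle_natCast]
      simp only [norm_zero, zero_pow hk0, norm_neg, norm_div, norm_mul, norm_natCast]
      norm_num
      refine ⟨by positivity, ?_⟩
      rw [div_lt_one (by positivity)]
      linarith
    · rw [mem_hartogsTriangle_natCast]
      simp only [norm_zero, zero_pow hk0]
      norm_num
    · simp only [hartogsKernel, kernelFun, zero_mul, kernelNumerator_zero hk0, ← hNdef]
      rw [div_eq_zero_iff]
      left
      simp only [map_div₀, map_ofNat]
      field_simp
      ring

theorem mainTheorem4 (k : ℕ) (hk : 2 ≤ k) : ¬ IsLuQiKeng (hartogsTriangle (k : ℝ)) := by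
  intro h
  obtain ⟨z, hz, w, hw, h0⟩ := exists_hartogsKernel_eq_zero hk
  exact h (hartogsKernel k) (isBergmanKernel_hartogsKernel (by omega)) z hz w hw h0
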